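/- Write $\widehat f$ for the Fourier transform on $L^2(\mathbb R^3)$ and set $\|f\|_{\mathcal Y^\sigma}=\operatorname{ess\,sup}_{\xi\in\mathbb R^3}|\xi|^\sigma|\widehat f(\xi)|$ and $\|f\|_{\dot H^{-\delta}}^2=\int_{\mathbb R^3}|\xi|^{-2\delta}|\widehat f(\xi)|^2\,d\xi$. Let $\sigma\in[-1,1]$ and $0<\delta<\frac32-\sigma$. Let $u_0\in L^2(\mathbb R^3;\mathbb R^3)$ with $\operatorname{div}u_0=0$ and $\|u_0\|_{\mathcal Y^\sigma}<\infty$, and let $u$ be a global weak solution of the incompressible Navier–Stokes equations $$u_t+u\cdot\nabla u+\nabla p-\Delta u=0,\qquad \operatorname{div}u=0,\qquad u(0)=u_0\qquad\text{on }\mathbb R^3,$$ that is, $u\in L^\infty(0,T;L^2)\cap L^2(0,T;H^1)$ for all $T>0$, $u$ is weakly continuous from $[0,\infty)$ to $L^2$, $\operatorname{div} u(t)=0$ in the sense of distributions for all $t\ge 0$, and for every divergence-free $\varphi\in C_c^\infty(\mathbb R^3;\mathbb R^3)$ and every $t\ge0$ $$\int u(t)\cdot\varphi\,dx=\int u_0\cdot\varphi\,dx+\int_0^t\!\int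 \Big(u\cdot\Delta\varphi+\sum_{i,j}u_iu_j\,\partial_i\varphi_j\Big)dx\,d\tau .$$ Assume that $u$ satisfies the energy inequality $$\|u(t)\|_{L^2}^2+2\int_s^t\|\nabla u(\tau)\|_{L^2}^2\,d\tau\le\|u(s)\|_{L^2}^2\qquad\text{for all }t>s,$$ for $s=0$ and for almost every $s>0$. Then there is a constant $C$, depending only on $\sigma$, $\delta$ and upper bounds for $\|u_0\|_{L^2}$ and $\|u_0\|_{\mathcal Y^\sigma}$, such that $$\|u(t)\|_{\dot H^{-\delta}}^2\le C\,(1+t)^{-\frac32+\sigma+\delta}\qquad\text{for all }t\ge0 .$$ -/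

import Mathlib

open MeasureTheory Set Filter Topology
open scoped ENNReal ContDiff InnerProductSpace FourierTransform Laplacian

noncomputable section

namespace NSE

/-- The physical space `ℝ³`, which is also the space of values of a velocity field. -/
abbrev E3 : Type := EuclideanSpace ℝ (Fin 3)

/-- The Hilbert space `L²(ℝ³; ℝ³)` of real vector fields. -/
abbrev L2Field : Type := Lp E3 2 (volume : Measure E3)

/-- The real-linear inclusion `ℝ³ ⊆ ℂ³`, coordinate by coordinate. -/
def complexify : E3 →L[ℝ] EuclideanSpace ℂ (Fin 3) :=
  LinearMap.toContinuousLinearMap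
    { toFun := fun v => WithLp.toLp 2 (fun i => ((v i : ℝ) : ℂ))
      map_add' := by
        intro v w
        ext i
        simp
      map_smul' := by
        intro c v
        ext i
        simp }

/-- The `L²` Fourier transform (with kernel `exp (-2 π i x · ξ)`) of a real vector field. -/
def fhat (f : L2Field) : Lp (EuclideanSpace ℂ (Fin 3)) 2 (volume : Measure E3) :=
  𝓕 (complexify.compLp f)

/-- The pseudo-measure norm `‖f‖_{𝒴^σ} = ess sup_ξ |ξ|^σ |f̂(ξ)|` of an `L²` field; the field
belongs to `𝒴^σ` iff this is finite. -/
def pseudoMeasureNorm (σ : ℝ) (f : L2Field) : ℝ≥0∞ :=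
  essSup (fun ξ : E3 => ENNReal.ofReal (‖ξ‖ ^ σ * ‖fhat f ξ‖)) volume

/-- The square of the homogeneous Sobolev norm,
`‖f‖²_{Ḣ^s} = ∫ |ξ|^{2s} |f̂(ξ)|² dξ`, of an `L²` field. -/
def homSobolevNormSq (s : ℝ) (f : L2Field) : ℝ≥0∞ :=
  ∫⁻ ξ : E3, ENNReal.ofReal (‖ξ‖ ^ (2 * s) * ‖fhat f ξ‖ ^ 2)

/-- `g` is the weak partial derivative `∂ᵢ f`. -/
def IsWeakPartial (i : Fin 3) (f g : L2Field) : Prop :=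
  ∀ φ : E3 → E3, ContDiff ℝ ∞ φ → HasCompactSupport φ →
    ∫ x, ⟪f x, fderiv ℝ φ x (EuclideanSpace.single i 1)⟫_ℝ = - ∫ x, ⟪g x, φ x⟫_ℝ

/-- `‖∇f‖²_{L²} = ∑ᵢ ‖∂ᵢ f‖²_{L²}`, with weak derivatives. These are unique, so the infimum runs
over at most one family; it is `∞` when `f` has no weak gradient in `L²`. -/
def gradNormSq (f : L2Field) : ℝ≥0∞ :=
  ⨅ (G : Fin 3 → L2Field) (_ : ∀ i, IsWeakPartial i f (G i)), ∑ i, ENNReal.ofReal (‖G i‖ ^ 2)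

/-- `div f = 0` in the sense of distributions. -/
def WeaklyDivFree (f : L2Field) : Prop :=
  ∀ φ : E3 → ℝ, ContDiff ℝ ∞ φ → HasCompactSupport φ → ∫ x, fderiv ℝ φ x (f x) = 0

/-- Smooth compactly supported divergence-free vector fields. -/
structure IsSolenoidalTest (φ : E3 → E3) : Prop where
  smooth : ContDiff ℝ ∞ φ
  compact : HasCompactSupport φ
  div_free : ∀ x, ∑ i : Fin 3, fderiv ℝ φ x (EuclideanSpace.single i 1) i = 0

/-- `u` is a global weak solution of the Navier-Stokes equations on `ℝ³` with viscosity `1`,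
`∂ₜu + u·∇u + ∇p - Δu = 0`, `div u = 0`, `u(0) = u₀`: it lies in
`L^∞(0,T;L²) ∩ L²(0,T;H¹)` for every `T`, is weakly continuous in time with values in `L²`, and
satisfies the equation tested with solenoidal fields, which removes the pressure. Note that
`⟪Dφ(x) u, u⟫ = ∑ᵢⱼ uᵢ uⱼ ∂ᵢφⱼ(x)`. Only the values `u t` with `0 ≤ t` matter. -/
structure IsWeakSolution (u₀ : L2Field) (u : ℝ → L2Field) : Prop where
  initial : u 0 = u₀
  weak_cont : ∀ v : L2Field, ContinuousOn (fun t => ⟪u t, v⟫_ℝ) (Ici 0)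
  bounded : ∀ T : ℝ, ∃ K : ℝ, ∀ t ∈ Icc 0 T, ‖u t‖ ≤ K
  grad_finite : ∀ T : ℝ, ∫⁻ τ in Ioc 0 T, gradNormSq (u τ) < ⊤
  div_free : ∀ t, 0 ≤ t → WeaklyDivFree (u t)
  momentum : ∀ φ : E3 → E3, IsSolenoidalTest φ → ∀ t, 0 ≤ t →
    ∫ x, ⟪u t x, φ x⟫_ℝ = (∫ x, ⟪u₀ x, φ x⟫_ℝ) +
      ∫ τ in (0 : ℝ)..t,
        ((∫ x, ⟪u τ x, (Δ φ) x⟫_ℝ) + ∫ x, ⟪fderiv ℝ φ x (u τ x), u τ x⟫_ℝ)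

/-- The energy inequality on all intervals with left end point `s`. -/
def EnergyInequalityFrom (u : ℝ → L2Field) (s : ℝ) : Prop :=
  ∀ t, s < t →
    ENNReal.ofReal (‖u t‖ ^ 2) + 2 * ∫⁻ τ in Ioc s t, gradNormSq (u τ) ≤
      ENNReal.ofReal (‖u s‖ ^ 2)

end NSE

end

/-!
The proof is Schonbek's Fourier splitting method, with a bootstrap that ends in the sharp energy
decay `‖u(t)‖² ≲ (1 + t)^{-3/2+σ}`.

*Low frequencies.* On the Fourier side the vorticity components `ξ_a û_b - ξ_b û_a` solve a heat
equation whose forcing is at most a multiple of `|ξ|² ‖u‖²_{L²}`, since the Fourier transform of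
`u ⊗ u` is bounded by `‖u‖²_{L²}`. Working with the vorticity means testing the equation with the
solenoidal fields `∂_a μ e_b - ∂_b μ e_a`, which needs no pressure; compactly supported potentials
`μ` are dense in the Schwartz space (`SchwartzMap.dense_hasCompactSupport`), so `μ` may be the real
or imaginary part of the Fourier transform of a bump function. Iterating the resulting integral
inequality (`le_mul_exp_of_hierarchy`) replaces Duhamel's formula, and as `ξ · û = 0` the
velocity is recovered from the vorticity: for `|ξ| < r` with `r² t ≲ 1`,
`|û(t, ξ)| ≲ |ξ|^{-σ} (1 + r^{1+σ} ∫₀ᵗ ‖u‖²)` (`IsWeakSolution.norm_fhat_le`).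

*Energy decay.* By Plancherel, `‖∇u‖² ≥ 4π² r² (‖u‖² - ∫_{|ξ|<r} |û|²)`. With `r² = 4 / (1 + t)`,
the energy inequality from a time `s` in `(t/4, t/2)` gives `E(t) ≤ E(s) / 64 + L` for `E = ‖u‖²` and
`L` the largest value of `∫_{|ξ|<r} |û|²` on `(s, t]`, and the factor `1/64` allows an induction
over dyadic times (`norm_sq_le_of_low_frequency_decay`). If `∫₀ᵗ E ≲ (1 + t)^a`, this yields decay
of `E` at the rate
`min (3/2 - σ) (5/2 - 2a)` (`exists_decay_of_energyBound`). Starting from `a = 1`, the rates are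
`1/2`, then `min (3/2 - σ) (3/2)`, and then `3/2 - σ` (`exists_energy_decay`).

*Negative Sobolev norms.* The low frequencies contribute
`∫_{|ξ|<r} |ξ|^{-2δ-2σ} ≲ r^{3-2σ-2δ}`, and the high ones at most `r^{-2δ} E(t)`; both are
`O((1 + t)^{-3/2+σ+δ})` for `r` of order `(1 + t)^{-1/2}`.
-/

/-! ### Density of compactly supported functions in the Schwartz space -/

/-- Compactly supported functions are dense in the Schwartz space: `χ(x / n) f(x) → f(x)`, since
on the support of `1 - χ(· / n)` a factor `‖x‖ / n ≥ 1` can be spent from the decay of `f`. -/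
theorem SchwartzMap.dense_hasCompactSupport {E F : Type*} [NormedAddCommGroup E]
    [NormedSpace ℝ E] [FiniteDimensional ℝ E] [HasContDiffBump E] [NormedAddCommGroup F]
    [NormedSpace ℝ F] : Dense {f : SchwartzMap E F | HasCompactSupport f} := by
  intro f
  let χ : ContDiffBump (0 : E) := ⟨1, 2, one_pos, one_lt_two⟩
  have hχ : ContDiff ℝ ∞ (χ : E → ℝ) := χ.contDiff
  let c : ℕ → ℝ := fun n => ((n : ℝ) + 1)⁻¹
  have hc0 : ∀ n, 0 < c n := fun n => by positivity
  have hc1 : ∀ n, c n ≤ 1 := fun n => inv_le_one_of_one_le₀ (by simp)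
  have hgs : ∀ n, ContDiff ℝ ∞ (fun x : E => χ (c n • x)) := fun n =>
    hχ.comp (contDiff_const_smul (c n))
  have hgc : ∀ n, HasCompactSupport (fun x : E => χ (c n • x)) := fun n =>
    χ.hasCompactSupport.comp_homeomorph (Homeomorph.smulOfNeZero (c n) (hc0 n).ne')
  have hfc : ∀ n, HasCompactSupport (fun x : E => χ (c n • x) • f x) := fun n =>
    (hgc n).smul_right
  let u : ℕ → SchwartzMap E F := fun n => (hfc n).toSchwartzMap ((hgs n).smul (f.smooth ⊤))
  refine mem_closure_of_tendsto (f := u) (b := atTop) ?_ (Eventually.of_forall fun n => hfc n)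
  rw [(schwartz_withSeminorms ℝ E F).tendsto_nhds]
  rintro ⟨k, m⟩ ε hε
  -- the derivatives of `1 - χ` are bounded
  have hD : ∀ i : ℕ, ∃ C, 0 ≤ C ∧ ∀ x, ‖iteratedFDeriv ℝ i (fun y => 1 - χ y) x‖ ≤ C := by
    intro i
    have h1 : HasCompactSupport (iteratedFDeriv ℝ i (χ : E → ℝ)) :=
      χ.hasCompactSupport.iteratedFDeriv i
    obtain ⟨C, hC⟩ := h1.exists_bound_of_continuous
      (hχ.continuous_iteratedFDeriv (mod_cast le_top))
    refine ⟨1 + C, by linarith [(norm_nonneg _).trans (hC 0)], fun x => ?_⟩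
    have : (fun y => 1 - χ y) = (fun _ => (1 : ℝ)) - (χ : E → ℝ) := rfl
    rw [this, iteratedFDeriv_sub_apply contDiffAt_const
      (hχ.contDiffAt.of_le (mod_cast le_top))]
    refine (norm_sub_le _ _).trans (add_le_add ?_ (hC x))
    rcases i with _ | i
    · simp
    · rw [iteratedFDeriv_succ_const]; simp
  choose D hD0 hD using hD
  set S : ℝ := ∑ i ∈ Finset.range (m + 1), (m.choose i) * D i *
    SchwartzMap.seminorm ℝ (k + 1) (m - i) f with hS
  have hS0 : 0 ≤ S := Finset.sum_nonneg fun i _ => by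
    have := hD0 i
    positivity
  have key : ∀ n, SchwartzMap.seminorm ℝ k m (u n - f) ≤ c n * S := by
    intro n
    refine SchwartzMap.seminorm_le_bound ℝ k m _ (mul_nonneg (hc0 n).le hS0) fun x => ?_
    have hfun : ((u n - f : SchwartzMap E F) : E → F) =
        fun x => -((1 - χ (c n • x)) • f x) := by
      ext x
      change χ (c n • x) • f x - f x = _
      rw [sub_smul, one_smul]; abel
    rw [hfun]
    have hg' : ContDiff ℝ ∞ (fun y : E => 1 - χ (c n • y)) := contDiff_const.sub (hgs n)
    by_cases hx : ‖x‖ < n + 1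
    · -- near such a point the difference vanishes identically
      have hz : (fun y => -((1 - χ (c n • y)) • f y)) =ᶠ[𝓝 x] fun _ => 0 := by
        filter_upwards [(isOpen_lt continuous_norm continuous_const).mem_nhds hx] with y hy
        have : χ (c n • y) = 1 := by
          apply χ.one_of_mem_closedBall
          rw [mem_closedBall_zero_iff, norm_smul, Real.norm_of_nonneg (hc0 n).le]
          change ((n : ℝ) + 1)⁻¹ * ‖y‖ ≤ 1
          rw [inv_mul_le_iff₀ (by positivity)]
          have hy' : ‖y‖ < n + 1 := hy
          linarith
        simp [this]
      rw [(hz.iteratedFDeriv ℝ m).self_of_nhds]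
      have : iteratedFDeriv ℝ m (fun _ : E => (0 : F)) x = 0 := by
        simp [iteratedFDeriv_fun_zero]
      rw [this, norm_zero, mul_zero]
      exact mul_nonneg (hc0 n).le hS0
    · push Not at hx
      have hx1 : 1 ≤ c n * ‖x‖ := by
        change 1 ≤ ((n : ℝ) + 1)⁻¹ * ‖x‖
        rwa [le_inv_mul_iff₀ (by positivity), mul_one]
      have h0 : ‖iteratedFDeriv ℝ m (fun y => -((1 - χ (c n • y)) • f y)) x‖ =
          ‖iteratedFDeriv ℝ m (fun y => (1 - χ (c n • y)) • f y) x‖ := by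
        rw [show (fun y => -((1 - χ (c n • y)) • f y)) =
          -(fun y => (1 - χ (c n • y)) • f y) from rfl, iteratedFDeriv_neg_apply, norm_neg]
      rw [h0]
      have h1 := norm_iteratedFDeriv_smul_le (𝕜 := ℝ) hg' (f.smooth ⊤) x (n := m)
        (mod_cast le_top)
      have h2 : ∀ i, ‖iteratedFDeriv ℝ i (fun y : E => 1 - χ (c n • y)) x‖ ≤ D i := by
        intro i
        have := congrFun (iteratedFDeriv_comp_const_smul (𝕜 := ℝ) (i := i) (c n)
          (f := fun y : E => 1 - χ y) ((contDiff_const.sub hχ).of_le (mod_cast le_top))) x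
        rw [this, norm_smul, norm_pow, Real.norm_of_nonneg (hc0 n).le]
        calc c n ^ i * _ ≤ 1 * D i :=
              mul_le_mul (pow_le_one₀ (hc0 n).le (hc1 n)) (hD i _) (norm_nonneg _) zero_le_one
          _ = D i := one_mul _
      calc ‖x‖ ^ k * ‖iteratedFDeriv ℝ m (fun y => (1 - χ (c n • y)) • f y) x‖
          ≤ (c n * ‖x‖) * (‖x‖ ^ k * ∑ i ∈ Finset.range (m + 1), (m.choose i) * D i *
              ‖iteratedFDeriv ℝ (m - i) f x‖) := by
            have h3 : ‖iteratedFDeriv ℝ m (fun y => (1 - χ (c n • y)) • f y) x‖ ≤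
                ∑ i ∈ Finset.range (m + 1), (m.choose i) * D i *
                ‖iteratedFDeriv ℝ (m - i) f x‖ := by
              refine h1.trans (Finset.sum_le_sum fun i _ => ?_)
              gcongr
              exact h2 i
            calc _ ≤ 1 * (‖x‖ ^ k * ∑ i ∈ Finset.range (m + 1), (m.choose i) * D i *
                ‖iteratedFDeriv ℝ (m - i) f x‖) := by
                  rw [one_mul]; gcongr
              _ ≤ _ := by
                refine mul_le_mul_of_nonneg_right hx1 ?_
                exact mul_nonneg (by positivity) ((norm_nonneg _).trans h3)
        _ = c n * ∑ i ∈ Finset.range (m + 1), (m.choose i) * D i *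
              (‖x‖ ^ (k + 1) * ‖iteratedFDeriv ℝ (m - i) f x‖) := by
            rw [Finset.mul_sum, Finset.mul_sum, Finset.mul_sum]
            refine Finset.sum_congr rfl fun i _ => ?_
            ring
        _ ≤ c n * S := by
            refine mul_le_mul_of_nonneg_left (Finset.sum_le_sum fun i _ => ?_) (hc0 n).le
            have := hD0 i
            gcongr
            exact f.le_seminorm ℝ (k + 1) (m - i) x
  have hlim : Tendsto (fun n => c n * S) atTop (𝓝 0) := by
    have : Tendsto c atTop (𝓝 0) := by
      simpa [c, one_div] using tendsto_one_div_add_atTop_nhds_zero_nat (𝕜 := ℝ)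
    simpa using this.mul_const S
  filter_upwards [hlim.eventually (gt_mem_nhds hε)] with n hn
  exact (key n).trans_lt hn

namespace NSE

noncomputable section

open scoped SchwartzMap LineDeriv

/-! ### Pairing with Schwartz functions and the Fourier transform -/

/-- The standard basis vector `e_j` of `ℝ³`. -/
def axis (j : Fin 3) : E3 := EuclideanSpace.single j 1

/-- The vector field `μ e_j`. -/
def coordField (j : Fin 3) : 𝓢(E3, ℝ) →L[ℝ] 𝓢(E3, E3) :=
  SchwartzMap.postcompCLM (ContinuousLinearMap.toSpanSingleton ℝ (axis j))

/-- The `L²` pairing `φ ↦ ∫ f · φ`, as a continuous functional on Schwartz fields. -/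
def pair (f : L2Field) : 𝓢(E3, E3) →L[ℝ] ℝ :=
  innerSL ℝ f ∘L SchwartzMap.toLpCLM ℝ E3 2 volume

/-- The pointwise real part of a Schwartz function. -/
def rePart : 𝓢(E3, ℂ) →L[ℝ] 𝓢(E3, ℝ) := SchwartzMap.postcompCLM Complex.reCLM

/-- The pointwise imaginary part of a Schwartz function. -/
def imPart : 𝓢(E3, ℂ) →L[ℝ] 𝓢(E3, ℝ) := SchwartzMap.postcompCLM Complex.imCLM

/-- Multiplication of a Schwartz function by the coordinate `ξ_a`, as a real-linear map. -/
def mulCoord (a : Fin 3) : 𝓢(E3, ℂ) →L[ℝ] 𝓢(E3, ℂ) :=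
  SchwartzMap.smulLeftCLM ℂ (fun ξ : E3 => ⟪ξ, axis a⟫_ℝ)

theorem inner_axis (x : E3) (j : Fin 3) : ⟪x, axis j⟫_ℝ = x j := by
  simp [axis, EuclideanSpace.inner_single_right]

theorem mulCoord_apply (a : Fin 3) (ψ : 𝓢(E3, ℂ)) (ξ : E3) :
    mulCoord a ψ ξ = (ξ a : ℂ) * ψ ξ := by
  have h : (fun ξ : E3 => ⟪ξ, axis a⟫_ℝ).HasTemperateGrowth := by fun_prop
  rw [mulCoord, SchwartzMap.smulLeftCLM_apply_apply h, inner_axis, Complex.real_smul]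

theorem lineDeriv_fourier (a : Fin 3) (ψ : 𝓢(E3, ℂ)) :
    ∂_{axis a} (𝓕 ψ) = -(2 * Real.pi * Complex.I) • 𝓕 (mulCoord a ψ) := by
  rw [SchwartzMap.lineDerivOp_fourier_eq, FourierTransform.fourier_smul]
  rfl

theorem pair_apply (f : L2Field) (φ : 𝓢(E3, E3)) : pair f φ = ∫ x, ⟪f x, φ x⟫_ℝ := by
  change ⟪f, φ.toLp 2 volume⟫_ℝ = _
  rw [L2.inner_def]
  refine integral_congr_ae ?_
  filter_upwards [φ.coeFn_toLp 2 volume] with x hx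
  rw [hx]

theorem coordField_apply (j : Fin 3) (μ : 𝓢(E3, ℝ)) (x : E3) :
    coordField j μ x = μ x • axis j := by
  simp [coordField]

theorem integrable_mul_coord (f : L2Field) (j : Fin 3) (ψ : 𝓢(E3, ℂ)) :
    Integrable (fun x => ψ x * (f x j : ℂ)) := by
  have h1 : MemLp (fun x => ((f x j : ℝ) : ℂ)) 2 volume :=
    (Lp.memLp f).continuousLinearMap_comp
      (Complex.ofRealCLM ∘L (EuclideanSpace.proj j : E3 →L[ℝ] ℝ))
  exact (ψ.memLp 2 volume).integrable_mul h1

theorem memLp_fhat_coord (f : L2Field) (j : Fin 3) : MemLp (fun ξ => fhat f ξ j) 2 volume :=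
  (Lp.memLp (fhat f)).continuousLinearMap_comp
    (EuclideanSpace.proj j : EuclideanSpace ℂ (Fin 3) →L[ℂ] ℂ)

theorem integrable_mul_fhat (f : L2Field) (j : Fin 3) (ψ : 𝓢(E3, ℂ)) :
    Integrable (fun ξ => ψ ξ * fhat f ξ j) :=
  (ψ.memLp 2 volume).integrable_mul (memLp_fhat_coord f j)

theorem integral_mul_coord (f : L2Field) (j : Fin 3) (m : 𝓢(E3, ℂ)) :
    ∫ x, m x * (f x j : ℂ) =
      pair f (coordField j (rePart m)) + pair f (coordField j (imPart m)) * Complex.I := by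
  have h := integrable_mul_coord f j m
  rw [← integral_re_add_im h, pair_apply, pair_apply]
  have hr : ∀ x, RCLike.re (m x * (f x j : ℂ)) = ⟪f x, coordField j (rePart m) x⟫_ℝ := by
    intro x
    simp [coordField_apply, inner_smul_right, inner_axis, rePart]
  have hi : ∀ x, RCLike.im (m x * (f x j : ℂ)) = ⟪f x, coordField j (imPart m) x⟫_ℝ := by
    intro x
    simp [coordField_apply, inner_smul_right, inner_axis, imPart]
  simp_rw [hr, hi]
  rfl

/-- The `L²` Fourier transform agrees with the one of tempered distributions: it moves to the test
function, component by component. -/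
theorem integral_mul_fhat (f : L2Field) (j : Fin 3) (ψ : 𝓢(E3, ℂ)) :
    ∫ ξ, ψ ξ * fhat f ξ j = ∫ x, (𝓕 ψ) x * (f x j : ℂ) := by
  set g : Lp (EuclideanSpace ℂ (Fin 3)) 2 (volume : Measure E3) := complexify.compLp f with hg
  have h := congrArg (fun T => T ψ) (Lp.fourier_toTemperedDistribution_eq g)
  simp only [TemperedDistribution.fourier_apply, Lp.toTemperedDistribution_apply] at h
  have hi1 : Integrable (fun x => (𝓕 ψ) x • g x) :=
    memLp_one_iff_integrable.1 ((Lp.memLp g).smul ((𝓕 ψ).memLp 2 volume) (r := 1))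
  have hi2 : Integrable (fun x =>
      ψ x • (𝓕 g : Lp (EuclideanSpace ℂ (Fin 3)) 2 (volume : Measure E3)) x) :=
    memLp_one_iff_integrable.1 ((Lp.memLp _).smul (ψ.memLp 2 volume) (r := 1))
  let P : EuclideanSpace ℂ (Fin 3) →L[ℂ] ℂ := EuclideanSpace.proj j
  have h2 := congrArg P h
  rw [← P.integral_comp_comm hi1, ← P.integral_comp_comm hi2] at h2
  change _ = ∫ ξ, ψ ξ * fhat f ξ j at h2
  rw [← h2]
  refine integral_congr_ae ?_
  filter_upwards [complexify.coeFn_compLp f] with x hx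
  change 𝓕 ψ x * (g x) j = _
  rw [hg, hx]
  rfl

theorem sum_smul_axis (v : E3) : ∑ a, v a • axis a = v := by
  ext i
  fin_cases i <;> simp [axis, Fin.sum_univ_three]

theorem lineDeriv_coordField (v : E3) (j : Fin 3) (μ : 𝓢(E3, ℝ)) :
    ∂_{v} (coordField j μ) = coordField j (∂_{v} μ) := by
  ext1 x
  rw [coordField_apply, SchwartzMap.lineDerivOp_apply_eq_fderiv,
    SchwartzMap.lineDerivOp_apply_eq_fderiv]
  have h : HasFDerivAt (coordField j μ) ((fderiv ℝ μ x).smulRight (axis j)) x := by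
    have := (μ.hasFDerivAt x).smul_const (axis j)
    refine this.congr_of_eventuallyEq (Eventually.of_forall fun y => coordField_apply j μ y)
  rw [h.fderiv]
  rfl

theorem lineDeriv_rePart (v : E3) (m : 𝓢(E3, ℂ)) :
    ∂_{v} (rePart m) = rePart (∂_{v} m) := by
  ext1 x
  change fderiv ℝ (rePart m) x (v) = (fderiv ℝ m x (v)).re
  have h : HasFDerivAt (rePart m) (Complex.reCLM ∘L (fderiv ℝ m x)) x :=
    Complex.reCLM.hasFDerivAt.comp x (m.hasFDerivAt x)
  rw [h.fderiv]
  rfl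

theorem lineDeriv_imPart (v : E3) (m : 𝓢(E3, ℂ)) :
    ∂_{v} (imPart m) = imPart (∂_{v} m) := by
  ext1 x
  change fderiv ℝ (imPart m) x (v) = (fderiv ℝ m x (v)).im
  have h : HasFDerivAt (imPart m) (Complex.imCLM ∘L (fderiv ℝ m x)) x :=
    Complex.imCLM.hasFDerivAt.comp x (m.hasFDerivAt x)
  rw [h.fderiv]
  rfl

/-- A weakly divergence-free field annihilates gradients of Schwartz functions, by density of the
compactly supported ones. -/
theorem WeaklyDivFree.sum_pair_eq_zero {f : L2Field} (hf : WeaklyDivFree f) (μ : 𝓢(E3, ℝ)) :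
    ∑ a, pair f (coordField a (∂_{axis a} μ)) = 0 := by
  let T : 𝓢(E3, ℝ) →L[ℝ] ℝ := ∑ a, pair f ∘L coordField a ∘L
    LineDeriv.lineDerivOpCLM ℝ 𝓢(E3, ℝ) (axis a)
  have hT : ∀ μ : 𝓢(E3, ℝ), T μ = ∑ a, pair f (coordField a (∂_{axis a} μ)) := by
    intro μ
    simp [T]
  rw [← hT]
  refine SchwartzMap.dense_hasCompactSupport.induction (P := fun μ => T μ = 0)
    (fun μ hμ => ?_) (isClosed_eq T.continuous continuous_const) μ
  rw [hT, ← map_sum, pair_apply, ← hf μ (μ.smooth ⊤) hμ]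
  refine integral_congr_ae (Eventually.of_forall fun x => ?_)
  simp only [_root_.sum_apply, coordField_apply, inner_sum, inner_smul_right, inner_axis]
  conv_rhs => rw [← sum_smul_axis (f x), map_sum]
  refine Finset.sum_congr rfl fun a _ => ?_
  rw [map_smul, smul_eq_mul, mul_comm]
  rfl

/-- Weak derivatives may be tested with Schwartz functions, by density of the compactly supported
ones. -/
theorem IsWeakPartial.pair_eq {i : Fin 3} {f g : L2Field} (h : IsWeakPartial i f g) (j : Fin 3)
    (μ : 𝓢(E3, ℝ)) : pair g (coordField j μ) = - pair f (coordField j (∂_{axis i} μ)) := by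
  let T : 𝓢(E3, ℝ) →L[ℝ] ℝ := pair f ∘L coordField j ∘L
    LineDeriv.lineDerivOpCLM ℝ 𝓢(E3, ℝ) (axis i)
  refine SchwartzMap.dense_hasCompactSupport.induction
    (P := fun μ => (pair g ∘L coordField j) μ = - T μ)
    (fun μ hμ => ?_) (isClosed_eq (pair g ∘L coordField j).continuous T.continuous.neg) μ
  change pair g (coordField j μ) = - pair f (coordField j (∂_{axis i} μ))
  have hc : HasCompactSupport (coordField j μ) := by
    refine hμ.mono' (fun x hx => subset_tsupport _ fun h0 => hx ?_)
    simp [coordField_apply, h0]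
  have := h (coordField j μ) ((coordField j μ).smooth ⊤) hc
  rw [pair_apply, pair_apply, ← lineDeriv_coordField]
  exact (neg_eq_iff_eq_neg.2 this).symm

theorem locallyIntegrable_mul_fhat {h : E3 → ℂ} (hh : Continuous h) (f : L2Field) (j : Fin 3) :
    LocallyIntegrable (fun ξ => h ξ * fhat f ξ j) := by
  have h1 := (memLp_fhat_coord f j).locallyIntegrable one_le_two
  rw [← locallyIntegrableOn_univ] at h1 ⊢
  exact h1.continuousOn_mul hh.continuousOn isOpen_univ.isLocallyClosed

/-! ### Divergence, gradient and energy on the Fourier side -/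

theorem ae_eq_of_integral_schwartz_mul_eq {g h : E3 → ℂ} (hg : LocallyIntegrable g)
    (hh : LocallyIntegrable h)
    (H : ∀ ψ : 𝓢(E3, ℂ), ∫ ξ, ψ ξ * g ξ = ∫ ξ, ψ ξ * h ξ) : g =ᵐ[volume] h := by
  refine ae_eq_of_integral_contDiff_smul_eq hg hh fun χ hχ hc => ?_
  have hc' : HasCompactSupport (fun ξ => (χ ξ : ℂ)) := hc.comp_left Complex.ofReal_zero
  have := H (hc'.toSchwartzMap (Complex.ofRealCLM.contDiff.comp hχ))
  simp_rw [Complex.real_smul]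
  exact this

theorem WeaklyDivFree.sum_mul_fhat_eq_zero {f : L2Field} (hf : WeaklyDivFree f) :
    ∀ᵐ ξ : E3, ∑ a, (ξ a : ℂ) * fhat f ξ a = 0 := by
  have hcont : ∀ a : Fin 3, Continuous (fun ξ : E3 => (ξ a : ℂ)) := fun a => by fun_prop
  refine ae_eq_of_integral_schwartz_mul_eq (h := fun _ => 0)
    (locallyIntegrable_finsetSum _ fun a _ => locallyIntegrable_mul_fhat (hcont a) f a)
    locallyIntegrable_zero fun ψ => ?_
  have h1 : ∀ ξ, ψ ξ * ∑ a, (ξ a : ℂ) * fhat f ξ a = ∑ a, mulCoord a ψ ξ * fhat f ξ a := by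
    intro ξ
    rw [Finset.mul_sum]
    refine Finset.sum_congr rfl fun a _ => ?_
    rw [mulCoord_apply]; ring
  simp_rw [h1, mul_zero, integral_zero]
  rw [integral_finsetSum _ fun a _ => integrable_mul_fhat f a _]
  have h2 : -(2 * Real.pi * Complex.I) * ∑ a, ∫ ξ, mulCoord a ψ ξ * fhat f ξ a = 0 := by
    rw [Finset.mul_sum]
    have h3 : ∀ a, -(2 * Real.pi * Complex.I) * ∫ ξ, mulCoord a ψ ξ * fhat f ξ a =
        pair f (coordField a (∂_{axis a} (rePart (𝓕 ψ)))) +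
        pair f (coordField a (∂_{axis a} (imPart (𝓕 ψ)))) * Complex.I := by
      intro a
      rw [integral_mul_fhat, lineDeriv_rePart, lineDeriv_imPart, ← integral_mul_coord,
        lineDeriv_fourier, ← integral_const_mul]
      refine integral_congr_ae (Eventually.of_forall fun x => ?_)
      simp [mul_assoc]
    simp_rw [h3]
    rw [Finset.sum_add_distrib, ← Finset.sum_mul, ← Complex.ofReal_sum, ← Complex.ofReal_sum,
      hf.sum_pair_eq_zero, hf.sum_pair_eq_zero]
    simp
  simpa [Real.pi_ne_zero] using h2

theorem IsWeakPartial.fhat_ae_eq {i : Fin 3} {f g : L2Field} (h : IsWeakPartial i f g)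
    (j : Fin 3) : ∀ᵐ ξ : E3, fhat g ξ j = (2 * Real.pi * Complex.I * ξ i) * fhat f ξ j := by
  refine ae_eq_of_integral_schwartz_mul_eq
    ((memLp_fhat_coord g j).locallyIntegrable one_le_two)
    (locallyIntegrable_mul_fhat (by fun_prop) f j) fun ψ => ?_
  have h1 : ∀ ξ, ψ ξ * ((2 * Real.pi * Complex.I * ξ i) * fhat f ξ j) =
      (2 * Real.pi * Complex.I) * (mulCoord i ψ ξ * fhat f ξ j) := by
    intro ξ
    rw [mulCoord_apply]; ring
  simp_rw [h1]
  rw [integral_const_mul, integral_mul_fhat, integral_mul_fhat, integral_mul_coord, h.pair_eq,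
    h.pair_eq, lineDeriv_rePart, lineDeriv_imPart, Complex.ofReal_neg, Complex.ofReal_neg,
    neg_mul, ← neg_add, ← integral_mul_coord, lineDeriv_fourier, ← integral_neg,
    ← integral_const_mul]
  refine integral_congr_ae (Eventually.of_forall fun x => ?_)
  simp [mul_assoc]

theorem _root_.MeasureTheory.Lp.ofReal_norm_sq_eq_lintegral {α F : Type*} [MeasurableSpace α]
    {μ : Measure α} [NormedAddCommGroup F] (g : Lp F 2 μ) :
    ENNReal.ofReal (‖g‖ ^ 2) = ∫⁻ x, ENNReal.ofReal (‖g x‖ ^ 2) ∂μ := by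
  have h := eLpNorm_eq_lintegral_rpow_enorm_toReal (μ := μ) (p := 2) two_ne_zero
    ENNReal.ofNat_ne_top (f := g)
  rw [ENNReal.ofReal_pow (norm_nonneg _), ofReal_norm, Lp.enorm_def, h]
  simp only [ENNReal.toReal_ofNat, one_div]
  rw [← ENNReal.rpow_natCast, ← ENNReal.rpow_mul]
  simp only [Nat.cast_ofNat, ne_eq, OfNat.ofNat_ne_zero, not_false_eq_true, inv_mul_cancel₀,
    ENNReal.rpow_one]
  refine lintegral_congr fun x => ?_
  rw [ENNReal.ofReal_pow (norm_nonneg _), ofReal_norm, ← ENNReal.rpow_natCast]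
  rfl

theorem norm_complexify (v : E3) : ‖complexify v‖ = ‖v‖ := by
  rw [EuclideanSpace.norm_eq, EuclideanSpace.norm_eq]
  congr 1
  refine Finset.sum_congr rfl fun i _ => ?_
  change ‖((v i : ℝ) : ℂ)‖ ^ 2 = _
  rw [Complex.norm_real]

theorem norm_fhat (f : L2Field) : ‖fhat f‖ = ‖f‖ := by
  rw [fhat, Lp.norm_fourier_eq, Lp.norm_def, Lp.norm_def]
  congr 1
  refine eLpNorm_congr_norm_ae ?_
  filter_upwards [complexify.coeFn_compLp f] with x hx
  rw [hx, norm_complexify]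

theorem lintegral_fhat_sq (f : L2Field) :
    ∫⁻ ξ, ENNReal.ofReal (‖fhat f ξ‖ ^ 2) = ENNReal.ofReal (‖f‖ ^ 2) := by
  rw [← norm_fhat, Lp.ofReal_norm_sq_eq_lintegral]

theorem measurable_fhat_sq (f : L2Field) :
    AEMeasurable (fun ξ => ENNReal.ofReal (‖fhat f ξ‖ ^ 2)) volume :=
  ((Lp.aestronglyMeasurable (fhat f)).norm.aemeasurable.pow_const 2).ennreal_ofReal

/-- Plancherel for the gradient, `‖∇f‖² ≥ 4π² ∫ |ξ|² |f̂|²`. Only this direction is needed; it is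
vacuous for fields without a weak gradient, where the right-hand side is `∞`. -/
theorem lintegral_le_gradNormSq (f : L2Field) :
    ∫⁻ ξ, ENNReal.ofReal (4 * Real.pi ^ 2 * ‖ξ‖ ^ 2 * ‖fhat f ξ‖ ^ 2) ≤ gradNormSq f := by
  refine le_iInf₂ fun G hG => le_of_eq ?_
  simp_rw [← lintegral_fhat_sq]
  rw [← lintegral_finsetSum' _ fun i _ => measurable_fhat_sq (G i)]
  refine lintegral_congr_ae ?_
  have h : ∀ᵐ ξ : E3, ∀ i j : Fin 3,
      fhat (G i) ξ j = (2 * Real.pi * Complex.I * ξ i) * fhat f ξ j := by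
    rw [ae_all_iff]; intro i
    rw [ae_all_iff]; intro j
    exact (hG i).fhat_ae_eq j
  filter_upwards [h] with ξ hξ
  rw [← ENNReal.ofReal_sum_of_nonneg fun i _ => by positivity]
  congr 1
  have h1 : ∀ i, ‖fhat (G i) ξ‖ ^ 2 = 4 * Real.pi ^ 2 * ‖ξ i‖ ^ 2 * ‖fhat f ξ‖ ^ 2 := by
    intro i
    rw [EuclideanSpace.norm_sq_eq, EuclideanSpace.norm_sq_eq, Finset.mul_sum]
    refine Finset.sum_congr rfl fun j _ => ?_
    rw [hξ i j]
    simp only [norm_mul, Complex.norm_ofNat, Complex.norm_real, Complex.norm_I, mul_pow]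
    rw [Real.norm_eq_abs Real.pi, sq_abs]
    ring
  simp_rw [h1]
  rw [← Finset.sum_mul, ← Finset.mul_sum, EuclideanSpace.norm_sq_eq ξ]

/-- The energy at frequencies above `r` is controlled by the gradient. -/
theorem energy_le_low_add_gradNormSq (f : L2Field) {r : ℝ} (hr : 0 < r) :
    ENNReal.ofReal (4 * Real.pi ^ 2 * r ^ 2) * ENNReal.ofReal (‖f‖ ^ 2) ≤
      ENNReal.ofReal (4 * Real.pi ^ 2 * r ^ 2) *
        (∫⁻ ξ in Metric.ball 0 r, ENNReal.ofReal (‖fhat f ξ‖ ^ 2)) + gradNormSq f := by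
  rw [← lintegral_fhat_sq, ← lintegral_add_compl (fun ξ => ENNReal.ofReal (‖fhat f ξ‖ ^ 2))
    (measurableSet_ball (x := (0 : E3)) (ε := r)), mul_add]
  refine add_le_add le_rfl (le_trans ?_ (lintegral_le_gradNormSq f))
  rw [← lintegral_const_mul' _ _ ENNReal.ofReal_ne_top]
  refine le_trans (setLIntegral_mono' measurableSet_ball.compl fun ξ hξ => ?_)
    (setLIntegral_le_lintegral _ _)
  rw [← ENNReal.ofReal_mul (by positivity)]
  have : r ≤ ‖ξ‖ := by simpa using hξ
  gcongr

/-! ### Testing the equation with solenoidal Schwartz fields -/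

theorem lineDeriv_comm (v w : E3) {F : Type*} [NormedAddCommGroup F] [NormedSpace ℝ F]
    (μ : 𝓢(E3, F)) : ∂_{v} (∂_{w} μ) = ∂_{w} (∂_{v} μ) := by
  ext1 x
  have h : IsSymmSndFDerivAt ℝ μ x :=
    ((μ.smooth ⊤).contDiffAt).isSymmSndFDerivAt (by
      rw [minSmoothness_of_isRCLikeNormedField]; 
      exact WithTop.coe_le_coe.2 (le_top : (2 : ℕ∞) ≤ ⊤))
  have h2 : ∀ v w : E3, (∂_{v} (∂_{w} μ)) x = fderiv ℝ (fderiv ℝ μ) x v w := by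
    intro v w
    have hd : DifferentiableAt ℝ (fderiv ℝ μ) x :=
      (SchwartzMap.fderivCLM ℝ E3 F μ).differentiableAt
    change fderiv ℝ (fun y => fderiv ℝ μ y w) x v = _
    rw [fderiv_clm_apply hd (differentiableAt_const w)]
    simp
  rw [h2, h2]
  exact h v w

/-- The solenoidal field `∂_a μ e_b - ∂_b μ e_a` with potential `μ`. -/
def rot (a b : Fin 3) : 𝓢(E3, ℝ) →L[ℝ] 𝓢(E3, E3) :=
  coordField b ∘L LineDeriv.lineDerivOpCLM ℝ 𝓢(E3, ℝ) (axis a) -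
    coordField a ∘L LineDeriv.lineDerivOpCLM ℝ 𝓢(E3, ℝ) (axis b)

theorem rot_apply (a b : Fin 3) (μ : 𝓢(E3, ℝ)) :
    rot a b μ = coordField b (∂_{axis a} μ) - coordField a (∂_{axis b} μ) := rfl

theorem lineDeriv_rot (v : E3) (a b : Fin 3) (μ : 𝓢(E3, ℝ)) :
    ∂_{v} (rot a b μ) = rot a b (∂_{v} μ) := by
  have h := (LineDeriv.lineDerivOpCLM ℝ 𝓢(E3, E3) v).map_sub
    (coordField b (∂_{axis a} μ)) (coordField a (∂_{axis b} μ))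
  simp only [LineDeriv.lineDerivOpCLM_apply] at h
  rw [rot_apply, rot_apply, h, lineDeriv_coordField, lineDeriv_coordField,
    lineDeriv_comm v, lineDeriv_comm v]

theorem isSolenoidalTest_rot (a b : Fin 3) {μ : 𝓢(E3, ℝ)} (hμ : HasCompactSupport μ) :
    IsSolenoidalTest (rot a b μ) where
  smooth := (rot a b μ).smooth ⊤
  compact := by
    have hc : ∀ c : Fin 3, HasCompactSupport (∂_{axis c} μ : 𝓢(E3, ℝ)) := fun c =>
      hμ.mono' ((subset_tsupport _).trans (SchwartzMap.tsupport_lineDerivOp_subset (axis c) μ))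
    refine ((hc a).smul_right (f' := fun _ => axis b)).sub
      ((hc b).smul_right (f' := fun _ => axis a)) |>.mono' ?_
    refine (subset_tsupport _).trans_eq' ?_
    congr 1
  div_free := by
    intro x
    have h : ∀ i : Fin 3, fderiv ℝ (rot a b μ) x (EuclideanSpace.single i 1) i =
        (∂_{axis i} (∂_{axis a} μ)) x * axis b i - (∂_{axis i} (∂_{axis b} μ)) x * axis a i := by
      intro i
      change (∂_{axis i} (rot a b μ)) x i = _
      rw [lineDeriv_rot, rot_apply, lineDeriv_comm (axis i), lineDeriv_comm (axis i)]
      simp [coordField_apply]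
    simp_rw [h]
    rw [Finset.sum_sub_distrib]
    have h2 : ∀ (g : Fin 3 → ℝ) (c : Fin 3), ∑ i, g i * axis c i = g c := by
      intro g c
      fin_cases c <;> simp [axis]
    rw [h2 (fun i => (∂_{axis i} (∂_{axis a} μ) : 𝓢(E3, ℝ)) x) b,
      h2 (fun i => (∂_{axis i} (∂_{axis b} μ) : 𝓢(E3, ℝ)) x) a, lineDeriv_comm]
    exact sub_self _

theorem laplacian_eq_sum_axis {F : Type*} [NormedAddCommGroup F] [NormedSpace ℝ F]
    (φ : 𝓢(E3, F)) : Δ φ = ∑ i, ∂_{axis i} (∂_{axis i} φ) := by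
  rw [SchwartzMap.laplacian_eq_sum (EuclideanSpace.basisFun (Fin 3) ℝ)]
  simp [axis]

theorem integral_norm_sq (f : L2Field) : ∫ x, ‖f x‖ ^ 2 = ‖f‖ ^ 2 := by
  rw [← real_inner_self_eq_norm_sq, L2.inner_def]
  simp

theorem integrable_norm_sq (f : L2Field) : Integrable (fun x => ‖f x‖ ^ 2) :=
  (Lp.memLp f).integrable_norm_pow two_ne_zero

/-- The nonlinear term is bounded by the energy times the sup norm of the gradient of the test
field. -/
theorem abs_integral_convection_le (f : L2Field) {φ : E3 → E3} {S : ℝ}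
    (hS : ∀ x, ‖fderiv ℝ φ x‖ ≤ S) :
    |∫ x, ⟪fderiv ℝ φ x (f x), f x⟫_ℝ| ≤ ‖f‖ ^ 2 * S := by
  rw [← integral_norm_sq f, ← integral_mul_const, ← Real.norm_eq_abs]
  refine norm_integral_le_of_norm_le ((integrable_norm_sq f).mul_const S)
    (Eventually.of_forall fun x => ?_)
  calc ‖⟪fderiv ℝ φ x (f x), f x⟫_ℝ‖ ≤ ‖fderiv ℝ φ x (f x)‖ * ‖f x‖ :=
        norm_inner_le_norm (𝕜 := ℝ) _ _
    _ ≤ (S * ‖f x‖) * ‖f x‖ := by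
      gcongr
      exact (fderiv ℝ φ x).le_of_opNorm_le (hS x) _
    _ = ‖f x‖ ^ 2 * S := by ring

theorem IsWeakSolution.continuousOn_pair {u₀ : L2Field} {u : ℝ → L2Field}
    (hu : IsWeakSolution u₀ u) (φ : 𝓢(E3, E3)) : ContinuousOn (fun t => pair (u t) φ) (Ici 0) :=
  hu.weak_cont (φ.toLp 2 volume)

theorem IsWeakSolution.continuous_integral_abs_inner {u₀ : L2Field} {u : ℝ → L2Field}
    (hu : IsWeakSolution u₀ u) {t : ℝ} (ht : 0 ≤ t) :
    Continuous fun y : L2Field => ∫ τ in (0 : ℝ)..t, |⟪u τ, y⟫_ℝ| := by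
  obtain ⟨K, hK⟩ := hu.bounded t
  rw [continuous_iff_continuousAt]
  intro y
  have hsub : uIoc 0 t ⊆ Ici (0 : ℝ) := by
    rw [uIoc_of_le ht]
    exact fun τ hτ => hτ.1.le
  refine intervalIntegral.continuousAt_of_dominated_interval (bound := fun _ => K * (‖y‖ + 1))
    (Eventually.of_forall fun z => ?_) ?_ ?_ ?_
  · exact (((hu.weak_cont z).abs).mono hsub).aestronglyMeasurable measurableSet_uIoc
  · filter_upwards [(continuous_norm.continuousAt (x := y)).eventually
      (gt_mem_nhds (lt_add_one ‖y‖))] with z hz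
    refine Eventually.of_forall fun τ hτ => ?_
    rw [uIoc_of_le ht] at hτ
    rw [Real.norm_eq_abs, abs_abs]
    have h1 := hK τ ⟨hτ.1.le, hτ.2⟩
    exact (abs_real_inner_le_norm _ _).trans (mul_le_mul h1 hz.le (norm_nonneg _)
      ((norm_nonneg _).trans h1))
  · exact intervalIntegrable_const
  · exact Eventually.of_forall fun τ _ => by fun_prop

/-- The equation tested with the solenoidal field of an arbitrary Schwartz potential, as an
inequality in which the nonlinear term is controlled by the energy. -/
theorem IsWeakSolution.abs_pair_rot_sub_le {u₀ : L2Field} {u : ℝ → L2Field}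
    (hu : IsWeakSolution u₀ u) {e : ℝ → ℝ} (he : ContinuousOn e (Ici 0))
    (hE : ∀ τ, 0 ≤ τ → ‖u τ‖ ^ 2 ≤ e τ) {t : ℝ} (ht : 0 ≤ t) (a b : Fin 3) (μ : 𝓢(E3, ℝ))
    {S : ℝ} (hS : ∀ x, ‖fderiv ℝ (rot a b μ) x‖ ≤ S) :
    |pair (u t) (rot a b μ) - pair u₀ (rot a b μ)| ≤
      ∫ τ in (0 : ℝ)..t, (|pair (u τ) (Δ (rot a b μ))| + e τ * S) := by
  have hsub : uIcc 0 t ⊆ Ici (0 : ℝ) := by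
    rw [uIcc_of_le ht]
    exact fun τ hτ => hτ.1
  have hei : IntervalIntegrable e volume 0 t := (he.mono hsub).intervalIntegrable
  have he0 : 0 ≤ ∫ τ in (0 : ℝ)..t, e τ :=
    intervalIntegral.integral_nonneg ht fun τ hτ => (sq_nonneg _).trans (hE τ hτ.1)
  have hpi : ∀ φ : 𝓢(E3, E3), IntervalIntegrable (fun τ => |pair (u τ) φ|) volume 0 t :=
    fun φ => (((hu.continuousOn_pair φ).abs).mono hsub).intervalIntegrable
  -- the sup norm of the gradient of the test field, as a continuous function of the potential
  let N : 𝓢(E3, ℝ) → ℝ := fun μ =>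
    ‖SchwartzMap.toBoundedContinuousFunctionCLM ℝ E3 (E3 →L[ℝ] E3)
      (SchwartzMap.fderivCLM ℝ E3 E3 (rot a b μ))‖
  have hN : ∀ μ x, ‖fderiv ℝ (rot a b μ) x‖ ≤ N μ := fun μ x =>
    BoundedContinuousFunction.norm_coe_le_norm (SchwartzMap.toBoundedContinuousFunctionCLM ℝ E3
      (E3 →L[ℝ] E3) (SchwartzMap.fderivCLM ℝ E3 E3 (rot a b μ))) x
  have key : |pair (u t) (rot a b μ) - pair u₀ (rot a b μ)| ≤
      (∫ τ in (0 : ℝ)..t, |pair (u τ) (Δ (rot a b μ))|) + (∫ τ in (0 : ℝ)..t, e τ) * N μ := by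
    refine SchwartzMap.dense_hasCompactSupport.induction (P := fun μ =>
      |pair (u t) (rot a b μ) - pair u₀ (rot a b μ)| ≤
      (∫ τ in (0 : ℝ)..t, |pair (u τ) (Δ (rot a b μ))|) + (∫ τ in (0 : ℝ)..t, e τ) * N μ)
      (fun μ hμ => ?_) (isClosed_le ?_ ?_) μ
    · have hm := hu.momentum _ (isSolenoidalTest_rot a b hμ) t ht
      simp_rw [← pair_apply, ← SchwartzMap.laplacian_apply, ← pair_apply] at hm
      rw [hm, add_sub_cancel_left, ← intervalIntegral.integral_mul_const,
        ← intervalIntegral.integral_add (hpi _) (hei.mul_const _), ← Real.norm_eq_abs]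
      -- this estimate needs no measurability in time of the nonlinear term
      refine intervalIntegral.norm_integral_le_of_norm_le ht ?_ ((hpi _).add (hei.mul_const _))
      refine Eventually.of_forall fun τ hτ => (norm_add_le _ _).trans (add_le_add le_rfl ?_)
      refine (abs_integral_convection_le (u τ) (hN μ)).trans ?_
      exact mul_le_mul_of_nonneg_right (hE τ hτ.1.le) (norm_nonneg _)
    · exact (((pair (u t)).continuous.comp (rot a b).continuous).sub
        ((pair u₀).continuous.comp (rot a b).continuous)).abs
    · refine Continuous.add ?_ (continuous_const.mul ?_)
      · exact (hu.continuous_integral_abs_inner ht).comp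
          ((SchwartzMap.toLpCLM ℝ E3 2 volume).continuous.comp
          ((LineDeriv.laplacianCLM ℝ E3 𝓢(E3, E3)).continuous.comp (rot a b).continuous))
      · exact (((SchwartzMap.toBoundedContinuousFunctionCLM ℝ E3 (E3 →L[ℝ] E3)).continuous.comp
          (SchwartzMap.fderivCLM ℝ E3 E3).continuous).comp (rot a b).continuous).norm
  rw [intervalIntegral.integral_add (hpi _) (hei.mul_const _), intervalIntegral.integral_mul_const]
  refine key.trans (add_le_add le_rfl (mul_le_mul_of_nonneg_left ?_ he0))
  exact (BoundedContinuousFunction.norm_le ((norm_nonneg _).trans (hS 0))).2 hS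

/-! ### The vorticity equation on the Fourier side -/

/-- Multiplication of a test function by the symbol `4π²|ξ|²` of `-Δ`. -/
def symbolMul : 𝓢(E3, ℂ) →L[ℝ] 𝓢(E3, ℂ) :=
  (4 * Real.pi ^ 2) • ∑ i, mulCoord i ∘L mulCoord i

theorem symbolMul_eq (ψ : 𝓢(E3, ℂ)) :
    symbolMul ψ = (4 * Real.pi ^ 2) • ∑ i, mulCoord i (mulCoord i ψ) := by
  simp [symbolMul]

theorem symbolMul_apply (ψ : 𝓢(E3, ℂ)) (ξ : E3) :
    symbolMul ψ ξ = ((4 * Real.pi ^ 2 * ‖ξ‖ ^ 2 : ℝ) : ℂ) * ψ ξ := by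
  rw [symbolMul_eq, smul_apply, _root_.sum_apply, EuclideanSpace.norm_sq_eq]
  simp only [mulCoord_apply, Complex.real_smul, Real.norm_eq_abs, sq_abs]
  push_cast
  rw [Finset.mul_sum, Finset.mul_sum, Finset.sum_mul]
  refine Finset.sum_congr rfl fun i _ => ?_
  ring

theorem laplacian_fourier (ψ : 𝓢(E3, ℂ)) : Δ (𝓕 ψ) = - 𝓕 (symbolMul ψ) := by
  have h : ∀ i : Fin 3, ∂_{axis i} (∂_{axis i} (𝓕 ψ)) =
      -(((4 * Real.pi ^ 2 : ℝ) : ℂ) • 𝓕 (mulCoord i (mulCoord i ψ))) := by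
    intro i
    rw [lineDeriv_fourier, LineDeriv.lineDerivOp_smul, lineDeriv_fourier, smul_smul, ← neg_smul]
    congr 1
    push_cast
    linear_combination (4 * (Real.pi : ℂ) ^ 2) * Complex.I_sq
  have h2 : symbolMul ψ = ((4 * Real.pi ^ 2 : ℝ) : ℂ) • ∑ i, mulCoord i (mulCoord i ψ) := by
    rw [symbolMul_eq]
    rfl
  rw [laplacian_eq_sum_axis, h2, FourierTransform.fourier_smul]
  simp_rw [h]
  rw [Finset.sum_neg_distrib, ← Finset.smul_sum]
  congr 2
  exact (map_sum (FourierTransform.fourierCLM ℂ 𝓢(E3, ℂ)) _ _).symm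

theorem laplacian_rot (a b : Fin 3) (μ : 𝓢(E3, ℝ)) : Δ (rot a b μ) = rot a b (Δ μ) := by
  simp_rw [laplacian_eq_sum_axis, lineDeriv_rot, map_sum]

theorem laplacian_rePart (m : 𝓢(E3, ℂ)) : Δ (rePart m) = rePart (Δ m) := by
  simp_rw [laplacian_eq_sum_axis, lineDeriv_rePart, map_sum]

theorem laplacian_imPart (m : 𝓢(E3, ℂ)) : Δ (imPart m) = imPart (Δ m) := by
  simp_rw [laplacian_eq_sum_axis, lineDeriv_imPart, map_sum]

/-- The component `ξ_a f̂_b - ξ_b f̂_a` of the Fourier transform of the vorticity (up to the factor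
`2πi`). -/
def vort (a b : Fin 3) (f : L2Field) (ξ : E3) : ℂ := ξ a * fhat f ξ b - ξ b * fhat f ξ a

/-- The vorticity tested with `ψ` on the Fourier side. -/
def vortPair (a b : Fin 3) (f : L2Field) (ψ : 𝓢(E3, ℂ)) : ℂ := ∫ ξ, ψ ξ * vort a b f ξ

theorem mul_vort_eq (a b : Fin 3) (f : L2Field) (ψ : 𝓢(E3, ℂ)) (ξ : E3) :
    ψ ξ * vort a b f ξ = mulCoord a ψ ξ * fhat f ξ b - mulCoord b ψ ξ * fhat f ξ a := by
  rw [vort, mulCoord_apply, mulCoord_apply]; ring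

theorem two_pi_I_mul_vortPair (a b : Fin 3) (f : L2Field) (ψ : 𝓢(E3, ℂ)) :
    -(2 * Real.pi * Complex.I) * vortPair a b f ψ =
      pair f (rot a b (rePart (𝓕 ψ))) + pair f (rot a b (imPart (𝓕 ψ))) * Complex.I := by
  have h3 : ∀ c d, -(2 * Real.pi * Complex.I) * ∫ ξ, mulCoord c ψ ξ * fhat f ξ d =
      pair f (coordField d (∂_{axis c} (rePart (𝓕 ψ)))) +
      pair f (coordField d (∂_{axis c} (imPart (𝓕 ψ)))) * Complex.I := by
    intro c d
    rw [integral_mul_fhat, lineDeriv_rePart, lineDeriv_imPart, ← integral_mul_coord,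
      lineDeriv_fourier, ← integral_const_mul]
    refine integral_congr_ae (Eventually.of_forall fun x => ?_)
    simp [mul_assoc]
  rw [vortPair]
  simp_rw [mul_vort_eq]
  rw [integral_sub (integrable_mul_fhat f b _) (integrable_mul_fhat f a _), mul_sub, h3, h3,
    rot_apply, rot_apply, map_sub, map_sub]
  push_cast
  ring

theorem norm_fourier_le (g : 𝓢(E3, ℂ)) (x : E3) : ‖(𝓕 g) x‖ ≤ ∫ ξ, ‖g ξ‖ := by
  rw [← SchwartzMap.norm_toLp_one]
  exact SchwartzMap.norm_fourier_apply_le_toLp_one g x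

theorem integrable_norm_sq_mul (ψ : 𝓢(E3, ℂ)) : Integrable (fun ξ => ‖ξ‖ ^ 2 * ‖ψ ξ‖) :=
  ψ.integrable_pow_mul volume 2

theorem norm_lineDeriv_fourier_le (v : E3) (c : Fin 3) (ψ : 𝓢(E3, ℂ)) (x : E3) :
    ‖(∂_{v} (∂_{axis c} (𝓕 ψ))) x‖ ≤ 4 * Real.pi ^ 2 * (∫ ξ, ‖ξ‖ ^ 2 * ‖ψ ξ‖) * ‖v‖ := by
  have hv : (fun ξ : E3 => ⟪ξ, v⟫_ℝ).HasTemperateGrowth := by fun_prop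
  rw [lineDeriv_fourier, LineDeriv.lineDerivOp_smul, SchwartzMap.lineDerivOp_fourier_eq,
    FourierTransform.fourier_smul, smul_smul, smul_apply, norm_smul]
  have h1 : ‖-(2 * (Real.pi : ℂ) * Complex.I) * -(2 * (Real.pi : ℂ) * Complex.I)‖ =
      4 * Real.pi ^ 2 := by
    rw [norm_mul, norm_neg]
    simp only [norm_mul, Complex.norm_ofNat, Complex.norm_real, Complex.norm_I]
    rw [Real.norm_of_nonneg Real.pi_pos.le]
    ring
  rw [h1, mul_assoc (4 * Real.pi ^ 2) (∫ ξ, ‖ξ‖ ^ 2 * ‖ψ ξ‖)]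
  refine mul_le_mul_of_nonneg_left ((norm_fourier_le _ x).trans ?_) (by positivity)
  rw [← integral_mul_const]
  refine integral_mono_of_nonneg (Eventually.of_forall fun ξ => norm_nonneg _)
    ((integrable_norm_sq_mul ψ).mul_const _) (Eventually.of_forall fun ξ => ?_)
  change ‖(SchwartzMap.smulLeftCLM ℂ (fun ξ : E3 => ⟪ξ, v⟫_ℝ) (mulCoord c ψ)) ξ‖ ≤ _
  rw [SchwartzMap.smulLeftCLM_apply_apply hv, mulCoord_apply, norm_smul, norm_mul,
    Complex.norm_real]
  have h2 : ‖⟪ξ, v⟫_ℝ‖ ≤ ‖ξ‖ * ‖v‖ := norm_inner_le_norm ξ v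
  have h3 : ‖ξ c‖ ≤ ‖ξ‖ := PiLp.norm_apply_le ξ c
  calc ‖⟪ξ, v⟫_ℝ‖ * (‖ξ c‖ * ‖ψ ξ‖) ≤ (‖ξ‖ * ‖v‖) * (‖ξ‖ * ‖ψ ξ‖) := by gcongr
    _ = _ := by ring

theorem norm_axis (j : Fin 3) : ‖axis j‖ = 1 := by simp [axis]

/-- A gradient bound for solenoidal fields whose potential has second derivatives dominated by those
of `𝓕 ψ`, such as its real and imaginary parts. -/
theorem norm_fderiv_rot_le (a b : Fin 3) {μ : 𝓢(E3, ℝ)} {ψ : 𝓢(E3, ℂ)}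
    (h : ∀ (v : E3) (c : Fin 3) (x : E3),
      |(∂_{v} (∂_{axis c} μ) : 𝓢(E3, ℝ)) x| ≤ ‖(∂_{v} (∂_{axis c} (𝓕 ψ)) : 𝓢(E3, ℂ)) x‖)
    (x : E3) :
    ‖fderiv ℝ (rot a b μ) x‖ ≤ 8 * Real.pi ^ 2 * ∫ ξ, ‖ξ‖ ^ 2 * ‖ψ ξ‖ := by
  have hI : 0 ≤ ∫ ξ, ‖ξ‖ ^ 2 * ‖ψ ξ‖ := integral_nonneg fun ξ => by positivity
  refine ContinuousLinearMap.opNorm_le_bound _ (by positivity) fun v => ?_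
  change ‖(∂_{v} (rot a b μ) : 𝓢(E3, E3)) x‖ ≤ _
  rw [lineDeriv_rot, rot_apply, sub_apply, coordField_apply, coordField_apply,
    lineDeriv_comm (axis a), lineDeriv_comm (axis b)]
  refine (norm_sub_le _ _).trans ?_
  rw [norm_smul, norm_smul, norm_axis, norm_axis, mul_one, mul_one]
  have h1 := (h v a x).trans (norm_lineDeriv_fourier_le v a ψ x)
  have h2 := (h v b x).trans (norm_lineDeriv_fourier_le v b ψ x)
  rw [Real.norm_eq_abs, Real.norm_eq_abs]
  linarith

theorem norm_fderiv_rot_rePart_le (a b : Fin 3) (ψ : 𝓢(E3, ℂ)) (x : E3) :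
    ‖fderiv ℝ (rot a b (rePart (𝓕 ψ))) x‖ ≤ 8 * Real.pi ^ 2 * ∫ ξ, ‖ξ‖ ^ 2 * ‖ψ ξ‖ := by
  refine norm_fderiv_rot_le a b (fun v c x => ?_) x
  rw [lineDeriv_rePart, lineDeriv_rePart]
  exact Complex.abs_re_le_norm _

theorem norm_fderiv_rot_imPart_le (a b : Fin 3) (ψ : 𝓢(E3, ℂ)) (x : E3) :
    ‖fderiv ℝ (rot a b (imPart (𝓕 ψ))) x‖ ≤ 8 * Real.pi ^ 2 * ∫ ξ, ‖ξ‖ ^ 2 * ‖ψ ξ‖ := by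
  refine norm_fderiv_rot_le a b (fun v c x => ?_) x
  rw [lineDeriv_imPart, lineDeriv_imPart]
  exact Complex.abs_im_le_norm _

theorem norm_two_pi_I_mul_vortPair (a b : Fin 3) (f : L2Field) (ψ : 𝓢(E3, ℂ)) :
    ‖(pair f (rot a b (rePart (𝓕 ψ))) + pair f (rot a b (imPart (𝓕 ψ))) * Complex.I : ℂ)‖ =
      2 * Real.pi * ‖vortPair a b f ψ‖ := by
  rw [← two_pi_I_mul_vortPair, norm_mul, norm_neg]
  simp only [norm_mul, Complex.norm_ofNat, Complex.norm_real, Complex.norm_I, mul_one]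
  rw [Real.norm_of_nonneg Real.pi_pos.le]

theorem abs_pair_rot_rePart_le (a b : Fin 3) (f : L2Field) (ψ : 𝓢(E3, ℂ)) :
    |pair f (rot a b (rePart (𝓕 ψ)))| ≤ 2 * Real.pi * ‖vortPair a b f ψ‖ := by
  rw [← norm_two_pi_I_mul_vortPair]
  simpa using Complex.abs_re_le_norm
    (pair f (rot a b (rePart (𝓕 ψ))) + pair f (rot a b (imPart (𝓕 ψ))) * Complex.I : ℂ)

theorem abs_pair_rot_imPart_le (a b : Fin 3) (f : L2Field) (ψ : 𝓢(E3, ℂ)) :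
    |pair f (rot a b (imPart (𝓕 ψ)))| ≤ 2 * Real.pi * ‖vortPair a b f ψ‖ := by
  rw [← norm_two_pi_I_mul_vortPair]
  simpa using Complex.abs_im_le_norm
    (pair f (rot a b (rePart (𝓕 ψ))) + pair f (rot a b (imPart (𝓕 ψ))) * Complex.I : ℂ)

theorem IsWeakSolution.continuousOn_norm_vortPair {u₀ : L2Field} {u : ℝ → L2Field}
    (hu : IsWeakSolution u₀ u) (a b : Fin 3) (ψ : 𝓢(E3, ℂ)) :
    ContinuousOn (fun t => ‖vortPair a b (u t) ψ‖) (Ici 0) := by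
  have h : (fun t => ‖vortPair a b (u t) ψ‖) = fun t => (2 * Real.pi)⁻¹ *
      ‖(pair (u t) (rot a b (rePart (𝓕 ψ))) +
        pair (u t) (rot a b (imPart (𝓕 ψ))) * Complex.I : ℂ)‖ := by
    funext t
    rw [norm_two_pi_I_mul_vortPair, inv_mul_cancel_left₀ (by positivity)]
  rw [h]
  have h1 := Complex.continuous_ofReal.comp_continuousOn
    (hu.continuousOn_pair (rot a b (rePart (𝓕 ψ))))
  have h2 := Complex.continuous_ofReal.comp_continuousOn
    (hu.continuousOn_pair (rot a b (imPart (𝓕 ψ))))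
  exact continuousOn_const.mul (h1.add (h2.mul continuousOn_const)).norm

/-- The vorticity equation on the Fourier side, tested with `ψ`. The factor `2` in the viscous term
comes from estimating real and imaginary parts separately; it only affects the rate of the
exponential in the later Gronwall argument. -/
theorem IsWeakSolution.norm_vortPair_le {u₀ : L2Field} {u : ℝ → L2Field}
    (hu : IsWeakSolution u₀ u) {e : ℝ → ℝ} (he : ContinuousOn e (Ici 0))
    (hE : ∀ τ, 0 ≤ τ → ‖u τ‖ ^ 2 ≤ e τ) {t : ℝ} (ht : 0 ≤ t) (a b : Fin 3) (ψ : 𝓢(E3, ℂ)) :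
    ‖vortPair a b (u t) ψ‖ ≤ ‖vortPair a b u₀ ψ‖ +
      8 * Real.pi * (∫ τ in (0 : ℝ)..t, e τ) * (∫ ξ, ‖ξ‖ ^ 2 * ‖ψ ξ‖) +
      2 * ∫ τ in (0 : ℝ)..t, ‖vortPair a b (u τ) (symbolMul ψ)‖ := by
  set I : ℝ := ∫ ξ, ‖ξ‖ ^ 2 * ‖ψ ξ‖ with hI
  have hsub : uIcc 0 t ⊆ Ici (0 : ℝ) := by
    rw [uIcc_of_le ht]
    exact fun τ hτ => hτ.1
  have hei : IntervalIntegrable e volume 0 t := (he.mono hsub).intervalIntegrable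
  have hvi : IntervalIntegrable (fun τ => ‖vortPair a b (u τ) (symbolMul ψ)‖) volume 0 t :=
    ((hu.continuousOn_norm_vortPair a b _).mono hsub).intervalIntegrable
  have hpi : ∀ φ : 𝓢(E3, E3), IntervalIntegrable (fun τ => |pair (u τ) φ|) volume 0 t :=
    fun φ => (((hu.continuousOn_pair φ).abs).mono hsub).intervalIntegrable
  have step : ∀ μ : 𝓢(E3, ℝ), (∀ x, ‖fderiv ℝ (rot a b μ) x‖ ≤ 8 * Real.pi ^ 2 * I) →
      (∀ τ, |pair (u τ) (Δ (rot a b μ))| ≤ 2 * Real.pi * ‖vortPair a b (u τ) (symbolMul ψ)‖) →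
      |pair (u t) (rot a b μ) - pair u₀ (rot a b μ)| ≤
        2 * Real.pi * (∫ τ in (0 : ℝ)..t, ‖vortPair a b (u τ) (symbolMul ψ)‖) +
          (∫ τ in (0 : ℝ)..t, e τ) * (8 * Real.pi ^ 2 * I) := by
    intro μ h1 h2
    refine (hu.abs_pair_rot_sub_le he hE ht a b μ h1).trans ?_
    rw [intervalIntegral.integral_add (hpi _) (hei.mul_const _),
      intervalIntegral.integral_mul_const, ← intervalIntegral.integral_const_mul]
    refine add_le_add ?_ le_rfl
    exact intervalIntegral.integral_mono_on ht (hpi _) (hvi.const_mul _) fun τ _ => h2 τ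
  have hre := step (rePart (𝓕 ψ)) (norm_fderiv_rot_rePart_le a b ψ) fun τ => by
    rw [laplacian_rot, laplacian_rePart, laplacian_fourier, map_neg, map_neg, map_neg, abs_neg]
    exact abs_pair_rot_rePart_le a b (u τ) (symbolMul ψ)
  have him := step (imPart (𝓕 ψ)) (norm_fderiv_rot_imPart_le a b ψ) fun τ => by
    rw [laplacian_rot, laplacian_imPart, laplacian_fourier, map_neg, map_neg, map_neg, abs_neg]
    exact abs_pair_rot_imPart_le a b (u τ) (symbolMul ψ)
  have h1 : 2 * Real.pi * ‖vortPair a b (u t) ψ - vortPair a b u₀ ψ‖ ≤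
      |pair (u t) (rot a b (rePart (𝓕 ψ))) - pair u₀ (rot a b (rePart (𝓕 ψ)))| +
      |pair (u t) (rot a b (imPart (𝓕 ψ))) - pair u₀ (rot a b (imPart (𝓕 ψ)))| := by
    have h2 : 2 * Real.pi * ‖vortPair a b (u t) ψ - vortPair a b u₀ ψ‖ =
        ‖-(2 * Real.pi * Complex.I) * (vortPair a b (u t) ψ - vortPair a b u₀ ψ)‖ := by
      rw [norm_mul, norm_neg]
      simp only [norm_mul, Complex.norm_ofNat, Complex.norm_real, Complex.norm_I, mul_one]
      rw [Real.norm_of_nonneg Real.pi_pos.le]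
    rw [h2, mul_sub, two_pi_I_mul_vortPair, two_pi_I_mul_vortPair]
    refine (le_of_eq (congrArg _ ?_)).trans ((norm_add_le
      (((pair (u t) (rot a b (rePart (𝓕 ψ))) - pair u₀ (rot a b (rePart (𝓕 ψ))) : ℝ) : ℂ))
      (((pair (u t) (rot a b (imPart (𝓕 ψ))) - pair u₀ (rot a b (imPart (𝓕 ψ))) : ℝ) : ℂ) *
        Complex.I)).trans (le_of_eq ?_))
    · push_cast; ring
    · rw [norm_mul, Complex.norm_I, mul_one, Complex.norm_real, Complex.norm_real]
      rfl
  have h3 : ‖vortPair a b (u t) ψ - vortPair a b u₀ ψ‖ ≤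
      8 * Real.pi * (∫ τ in (0 : ℝ)..t, e τ) * I +
      2 * ∫ τ in (0 : ℝ)..t, ‖vortPair a b (u τ) (symbolMul ψ)‖ := by
    refine le_of_mul_le_mul_left ?_ (by positivity : 0 < 2 * Real.pi)
    refine (h1.trans (add_le_add hre him)).trans (le_of_eq ?_)
    ring
  have h4 := norm_sub_norm_le (vortPair a b (u t) ψ) (vortPair a b u₀ ψ)
  linarith

/-! ### A Gronwall inequality for hierarchies -/

/-- A Gronwall inequality for a hierarchy: if each `g k` is controlled by the time integral of
`g (k + 1)` and the `g k` grow at most geometrically in `k`, then iterating the hypothesis gives the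
exponential bound. -/
theorem le_mul_exp_of_hierarchy {g : ℕ → ℝ → ℝ} {T N Q l : ℝ} (hl : 0 ≤ l)
    (hg : ∀ k, ContinuousOn (g k) (Icc 0 T))
    (h1 : ∀ k, ∀ t ∈ Icc 0 T, g k t ≤ l ^ k * N + 2 * ∫ τ in (0 : ℝ)..t, g (k + 1) τ)
    (hN : 0 ≤ N) (h2 : ∀ k, ∀ t ∈ Icc 0 T, g k t ≤ l ^ k * Q) {t : ℝ} (ht : t ∈ Icc 0 T) :
    g 0 t ≤ Real.exp (2 * l * t) * N := by
  have key : ∀ n k, ∀ t ∈ Icc 0 T, g k t ≤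
      l ^ k * (N * Real.exp (2 * l * t) + Q * ((2 * l * t) ^ n / n.factorial)) := by
    intro n
    induction n with
    | zero =>
      intro k t ht
      refine (h2 k t ht).trans (mul_le_mul_of_nonneg_left ?_ (pow_nonneg hl k))
      simp only [pow_zero, Nat.factorial_zero, Nat.cast_one, div_one, mul_one]
      exact le_add_of_nonneg_left (by positivity)
    | succ n ih =>
      intro k t ht
      -- `F` bounds `g (k + 1)` by induction, and `G` is an antiderivative of `F`
      let F : ℝ → ℝ := fun s =>
        l ^ (k + 1) * (N * Real.exp (2 * l * s) + Q * ((2 * l * s) ^ n / n.factorial))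
      let G : ℝ → ℝ := fun s => l ^ k / 2 *
        (N * Real.exp (2 * l * s) + Q * ((2 * l * s) ^ (n + 1) / (n + 1).factorial))
      have hFc : Continuous F := by fun_prop
      have hG : ∀ s, HasDerivAt G (F s) s := by
        intro s
        have hlin : HasDerivAt (fun s : ℝ => 2 * l * s) (2 * l) s := by
          simpa using (hasDerivAt_id s).const_mul (2 * l)
        have := (((hlin.exp.const_mul N).add
          (((hlin.pow (n + 1)).div_const ((n + 1).factorial : ℝ)).const_mul Q)).const_mul
          (l ^ k / 2))
        refine this.congr_deriv ?_
        simp only [F, Nat.factorial_succ, Nat.add_sub_cancel]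
        push_cast
        have : ((n.factorial : ℝ)) ≠ 0 := by positivity
        field_simp
        ring
      have hint : ∫ τ in (0 : ℝ)..t, g (k + 1) τ ≤ ∫ τ in (0 : ℝ)..t, F τ := by
        refine intervalIntegral.integral_mono_on ht.1 ?_ (hFc.intervalIntegrable _ _)
          fun τ hτ => ih (k + 1) τ ⟨hτ.1, hτ.2.trans ht.2⟩
        refine ((hg (k + 1)).mono ?_).intervalIntegrable
        rw [uIcc_of_le ht.1]
        exact Icc_subset_Icc_right ht.2
      rw [intervalIntegral.integral_eq_sub_of_hasDerivAt (fun s _ => hG s)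
        (hFc.intervalIntegrable _ _)] at hint
      have h3 := h1 k t ht
      have hG0 : G 0 = l ^ k / 2 * N := by simp [G]
      calc g k t ≤ l ^ k * N + 2 * (G t - G 0) := by linarith
        _ = _ := by
          rw [hG0]
          simp only [G]
          ring
  have hlim : Tendsto (fun n : ℕ => N * Real.exp (2 * l * t) +
      Q * ((2 * l * t) ^ n / n.factorial)) atTop (𝓝 (N * Real.exp (2 * l * t) + Q * 0)) :=
    ((FloorSemiring.tendsto_pow_div_factorial_atTop (2 * l * t)).const_mul Q).const_add _
  rw [mul_zero, add_zero] at hlim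
  rw [mul_comm]
  refine ge_of_tendsto' hlim fun n => ?_
  simpa using key n 0 t ht

/-! ### Pointwise bounds on the vorticity -/

theorem norm_vort_le (a b : Fin 3) (f : L2Field) (ξ : E3) :
    ‖vort a b f ξ‖ ≤ 2 * ‖ξ‖ * ‖fhat f ξ‖ := by
  have h : ∀ c d, ‖(ξ c : ℂ) * fhat f ξ d‖ ≤ ‖ξ‖ * ‖fhat f ξ‖ := by
    intro c d
    rw [norm_mul, Complex.norm_real]
    exact mul_le_mul (PiLp.norm_apply_le ξ c) (PiLp.norm_apply_le _ d) (norm_nonneg _)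
      (norm_nonneg _)
  refine (norm_sub_le _ _).trans ?_
  linarith [h a b, h b a]

theorem iterate_symbolMul_apply (k : ℕ) (ψ : 𝓢(E3, ℂ)) (ξ : E3) :
    (symbolMul^[k] ψ) ξ = ((4 * Real.pi ^ 2 * ‖ξ‖ ^ 2 : ℝ) : ℂ) ^ k * ψ ξ := by
  induction k with
  | zero => simp
  | succ k ih => rw [Function.iterate_succ_apply', symbolMul_apply, ih, pow_succ']; ring

theorem norm_iterate_symbolMul_le (k : ℕ) {ψ : 𝓢(E3, ℂ)} {r : ℝ}
    (hψ : ∀ ξ, ψ ξ ≠ 0 → ‖ξ‖ ≤ r) (ξ : E3) :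
    ‖(symbolMul^[k] ψ) ξ‖ ≤ (4 * Real.pi ^ 2 * r ^ 2) ^ k * ‖ψ ξ‖ := by
  rw [iterate_symbolMul_apply]
  by_cases h : ψ ξ = 0
  · simp [h]
  · rw [norm_mul, norm_pow, Complex.norm_real, Real.norm_of_nonneg (by positivity)]
    have := hψ ξ h
    gcongr

/-- Duhamel's formula, as an estimate: a bound `h₀` on the initial vorticity propagates, with the
forcing bounded by the time integral `M` of the energy. -/
theorem IsWeakSolution.norm_vortPair_le_exp {u₀ : L2Field} {u : ℝ → L2Field}
    (hu : IsWeakSolution u₀ u) {e : ℝ → ℝ} (he : ContinuousOn e (Ici 0))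
    (hE : ∀ τ, 0 ≤ τ → ‖u τ‖ ^ 2 ≤ e τ) {t M : ℝ} (ht : 0 ≤ t)
    (hM : ∫ τ in (0 : ℝ)..t, e τ ≤ M) (a b : Fin 3) {h₀ : E3 → ℝ} (hc : Continuous h₀)
    (h0 : ∀ᵐ ξ, ‖vort a b u₀ ξ‖ ≤ h₀ ξ) {ψ : 𝓢(E3, ℂ)} (hψc : HasCompactSupport ψ) {r : ℝ}
    (hψ : ∀ ξ, ψ ξ ≠ 0 → ‖ξ‖ ≤ r) :
    ‖vortPair a b (u t) ψ‖ ≤ Real.exp (2 * (4 * Real.pi ^ 2 * r ^ 2) * t) *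
      ∫ ξ, ‖ψ ξ‖ * (h₀ ξ + 8 * Real.pi * M * ‖ξ‖ ^ 2) := by
  set l : ℝ := 4 * Real.pi ^ 2 * r ^ 2 with hl
  have hl0 : 0 ≤ l := by positivity
  have hint : ∀ {h : E3 → ℝ}, Continuous h → Integrable (fun ξ => ‖ψ ξ‖ * h ξ) := by
    intro h hh
    refine (ψ.continuous.norm.mul hh).integrable_of_hasCompactSupport ?_
    exact hψc.norm.mul_right
  obtain ⟨K, hK⟩ := hu.bounded t
  have hM0 : 0 ≤ M := le_trans (intervalIntegral.integral_nonneg ht fun τ hτ =>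
    (sq_nonneg _).trans (hE τ hτ.1)) hM
  have hsplit : ∫ ξ, ‖ψ ξ‖ * (h₀ ξ + 8 * Real.pi * M * ‖ξ‖ ^ 2) =
      (∫ ξ, ‖ψ ξ‖ * h₀ ξ) + 8 * Real.pi * M * ∫ ξ, ‖ξ‖ ^ 2 * ‖ψ ξ‖ := by
    rw [← integral_const_mul, ← integral_add (hint hc) ((integrable_norm_sq_mul ψ).const_mul _)]
    refine integral_congr_ae (Eventually.of_forall fun ξ => ?_)
    simp only
    ring
  have hI0 : 0 ≤ ∫ ξ, ‖ξ‖ ^ 2 * ‖ψ ξ‖ := integral_nonneg fun ξ => by positivity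
  have hJ0 : 0 ≤ ∫ ξ, ‖ψ ξ‖ * h₀ ξ := integral_nonneg_of_ae (by
    filter_upwards [h0] with ξ hξ
    exact mul_nonneg (norm_nonneg _) ((norm_nonneg _).trans hξ))
  refine le_mul_exp_of_hierarchy (g := fun k τ => ‖vortPair a b (u τ) (symbolMul^[k] ψ)‖)
    (T := t) (Q := (∫ ξ, ‖ψ ξ‖ * (‖ψ ξ‖ * ‖ξ‖ ^ 2)) + K ^ 2) hl0
    (fun k => (hu.continuousOn_norm_vortPair a b _).mono Icc_subset_Ici_self) ?_ ?_ ?_ ⟨ht, le_rfl⟩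
  · intro k τ hτ
    have h1 := hu.norm_vortPair_le he hE hτ.1 a b (symbolMul^[k] ψ)
    rw [Function.iterate_succ_apply']
    refine h1.trans (add_le_add ?_ le_rfl)
    rw [hsplit, mul_add]
    refine add_le_add ?_ ?_
    · rw [← integral_const_mul]
      refine norm_integral_le_of_norm_le ((hint hc).const_mul _) ?_
      filter_upwards [h0] with ξ hξ
      rw [norm_mul, ← mul_assoc]
      exact mul_le_mul (norm_iterate_symbolMul_le k hψ ξ) hξ (norm_nonneg _) (by positivity)
    · have hMτ : ∫ s in (0 : ℝ)..τ, e s ≤ M := by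
        refine le_trans (intervalIntegral.integral_mono_interval le_rfl hτ.1 hτ.2 ?_ ?_) hM
        · refine (ae_restrict_iff' measurableSet_Ioc).2 (Eventually.of_forall fun s hs => ?_)
          exact (sq_nonneg _).trans (hE s hs.1.le)
        · refine (he.mono ?_).intervalIntegrable
          rw [uIcc_of_le ht]
          exact Icc_subset_Ici_self
      have hIk : ∫ ξ, ‖ξ‖ ^ 2 * ‖(symbolMul^[k] ψ) ξ‖ ≤ l ^ k * ∫ ξ, ‖ξ‖ ^ 2 * ‖ψ ξ‖ := by
        rw [← integral_const_mul]
        refine integral_mono (integrable_norm_sq_mul _) ((integrable_norm_sq_mul ψ).const_mul _)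
          fun ξ => ?_
        have := norm_iterate_symbolMul_le k hψ ξ
        calc ‖ξ‖ ^ 2 * ‖(symbolMul^[k] ψ) ξ‖ ≤ ‖ξ‖ ^ 2 * (l ^ k * ‖ψ ξ‖) := by gcongr
          _ = _ := by ring
      calc 8 * Real.pi * (∫ s in (0 : ℝ)..τ, e s) * ∫ ξ, ‖ξ‖ ^ 2 * ‖(symbolMul^[k] ψ) ξ‖
          ≤ 8 * Real.pi * M * (l ^ k * ∫ ξ, ‖ξ‖ ^ 2 * ‖ψ ξ‖) := by
            have : 0 ≤ ∫ ξ, ‖ξ‖ ^ 2 * ‖(symbolMul^[k] ψ) ξ‖ :=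
              integral_nonneg fun ξ => by positivity
            gcongr
        _ = _ := by ring
  · rw [hsplit]; positivity
  · -- `2 |ξ| |ψ| |û| ≤ (|ξ| |ψ|)² + |û|²`, and the last term integrates to the energy
    intro k τ hτ
    have hi1 : Integrable (fun ξ => ‖ψ ξ‖ * (‖ψ ξ‖ * ‖ξ‖ ^ 2)) := hint (by fun_prop)
    have hi2 : Integrable (fun ξ => ‖fhat (u τ) ξ‖ ^ 2) :=
      (Lp.memLp (fhat (u τ))).integrable_norm_pow two_ne_zero
    have hn : ∫ ξ, ‖fhat (u τ) ξ‖ ^ 2 = ‖u τ‖ ^ 2 := by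
      rw [integral_eq_lintegral_of_nonneg_ae (Eventually.of_forall fun _ => sq_nonneg _)
        hi2.aestronglyMeasurable, lintegral_fhat_sq, ENNReal.toReal_ofReal (sq_nonneg _)]
    calc ‖vortPair a b (u τ) (symbolMul^[k] ψ)‖
        ≤ ∫ ξ, l ^ k * (‖ψ ξ‖ * (‖ψ ξ‖ * ‖ξ‖ ^ 2) + ‖fhat (u τ) ξ‖ ^ 2) := by
          refine norm_integral_le_of_norm_le ((hi1.add hi2).const_mul _)
            (Eventually.of_forall fun ξ => ?_)
          rw [norm_mul]
          calc ‖(symbolMul^[k] ψ) ξ‖ * ‖vort a b (u τ) ξ‖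
              ≤ (l ^ k * ‖ψ ξ‖) * (2 * ‖ξ‖ * ‖fhat (u τ) ξ‖) := by
                gcongr
                · exact norm_iterate_symbolMul_le k hψ ξ
                · exact norm_vort_le a b (u τ) ξ
            _ = l ^ k * (2 * (‖ψ ξ‖ * ‖ξ‖) * ‖fhat (u τ) ξ‖) := by ring
            _ ≤ _ := by
                gcongr
                nlinarith [two_mul_le_add_sq (‖ψ ξ‖ * ‖ξ‖) ‖fhat (u τ) ξ‖]
      _ = l ^ k * ((∫ ξ, ‖ψ ξ‖ * (‖ψ ξ‖ * ‖ξ‖ ^ 2)) + ‖u τ‖ ^ 2) := by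
          rw [integral_const_mul, integral_add hi1 hi2, hn]
      _ ≤ _ := by
          have := hK τ hτ
          gcongr

theorem locallyIntegrable_vort (a b : Fin 3) (f : L2Field) : LocallyIntegrable (vort a b f) :=
  (locallyIntegrable_mul_fhat (by fun_prop) f b).sub (locallyIntegrable_mul_fhat (by fun_prop) f a)

/-- The pointwise form of `norm_vortPair_le_exp`, obtained by testing with bump functions
concentrating at a point. -/
theorem IsWeakSolution.norm_vort_le_exp {u₀ : L2Field} {u : ℝ → L2Field}
    (hu : IsWeakSolution u₀ u) {e : ℝ → ℝ} (he : ContinuousOn e (Ici 0))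
    (hE : ∀ τ, 0 ≤ τ → ‖u τ‖ ^ 2 ≤ e τ) {t M : ℝ} (ht : 0 ≤ t)
    (hM : ∫ τ in (0 : ℝ)..t, e τ ≤ M) (a b : Fin 3) {h₀ : E3 → ℝ} (hc : Continuous h₀)
    (h0 : ∀ᵐ ξ, ‖vort a b u₀ ξ‖ ≤ h₀ ξ) (r : ℝ) :
    ∀ᵐ ξ : E3, ‖ξ‖ < r → ‖vort a b (u t) ξ‖ ≤
      Real.exp (2 * (4 * Real.pi ^ 2 * r ^ 2) * t) * (h₀ ξ + 8 * Real.pi * M * ‖ξ‖ ^ 2) := by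
  let c : ℕ → ℝ := fun n => 1 / ((n : ℝ) + 1)
  have hc0 : ∀ n, 0 < c n := fun n => by positivity
  have hclim : Tendsto (fun n => 2 * c n) atTop (𝓝 0) := by
    simpa [c] using (tendsto_one_div_add_atTop_nhds_zero_nat (𝕜 := ℝ)).const_mul 2
  let φ : ℕ → ContDiffBump (0 : E3) := fun n =>
    ⟨c n, 2 * c n, hc0 n, by linarith [hc0 n]⟩
  have hφ : Tendsto (fun n => (φ n).rOut) atTop (𝓝 0) := hclim
  have hφ' : ∀ᶠ n in atTop, (φ n).rOut ≤ 2 * (φ n).rIn := Eventually.of_forall fun n => le_rfl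
  set h : E3 → ℝ := fun ξ => h₀ ξ + 8 * Real.pi * M * ‖ξ‖ ^ 2 with hh
  have hhc : Continuous h := by fun_prop
  filter_upwards [ContDiffBump.ae_convolution_tendsto_right_of_locallyIntegrable hφ hφ'
      (locallyIntegrable_vort a b (u t)),
    ContDiffBump.ae_convolution_tendsto_right_of_locallyIntegrable hφ hφ'
      (hhc.locallyIntegrable (μ := volume))] with ξ₀ h1 h2 hξ₀
  refine le_of_tendsto_of_tendsto h1.norm (h2.const_mul _) ?_
  have hev : ∀ᶠ n in atTop, 2 * c n < r - ‖ξ₀‖ :=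
    hclim.eventually (gt_mem_nhds (by linarith))
  filter_upwards [hev] with n hn
  have hs : ContDiff ℝ ∞ (fun ξ : E3 => (((φ n).normed volume (ξ₀ - ξ) : ℝ) : ℂ)) :=
    Complex.ofRealCLM.contDiff.comp ((φ n).contDiff_normed.comp (contDiff_const.sub contDiff_id))
  have hcs : HasCompactSupport (fun ξ : E3 => (((φ n).normed volume (ξ₀ - ξ) : ℝ) : ℂ)) := by
    have := ((φ n).hasCompactSupport_normed (μ := volume)).comp_homeomorph
      (Homeomorph.subLeft ξ₀)
    exact this.comp_left Complex.ofReal_zero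
  have hsupp : ∀ ξ, hcs.toSchwartzMap hs ξ ≠ 0 → ‖ξ‖ ≤ r := by
    intro ξ hξ
    have h3 : (φ n).normed volume (ξ₀ - ξ) ≠ 0 := fun h0 => hξ (by simp [h0])
    have h4 : ξ₀ - ξ ∈ Metric.ball (0 : E3) (φ n).rOut := by
      rw [← (φ n).support_normed_eq (μ := volume)]
      exact h3
    have h5 : ‖ξ₀ - ξ‖ < 2 * c n := by simpa using h4
    have h6 := norm_sub_norm_le ξ ξ₀
    rw [norm_sub_rev] at h6
    linarith
  have key := hu.norm_vortPair_le_exp he hE ht hM a b hc h0 (ψ := hcs.toSchwartzMap hs) hcs hsupp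
  rw [convolution_eq_swap, convolution_eq_swap]
  simp only [ContinuousLinearMap.lsmul_apply, Complex.real_smul, smul_eq_mul]
  refine (le_of_eq ?_).trans (key.trans (le_of_eq ?_))
  · rfl
  · congr 1
    refine integral_congr_ae (Eventually.of_forall fun ξ => ?_)
    simp only [HasCompactSupport.toSchwartzMap_toFun]
    congr 1
    change ‖(((φ n).normed volume (ξ₀ - ξ) : ℝ) : ℂ)‖ = _
    rw [Complex.norm_real, Real.norm_of_nonneg ((φ n).nonneg_normed _)]

/-! ### Low frequencies of the velocity -/

/-- Lagrange's identity for a real and a complex vector which are orthogonal to each other. -/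
theorem norm_sq_mul_norm_sq_of_sum_eq_zero (ξ : E3) (z : EuclideanSpace ℂ (Fin 3))
    (h : ∑ a, (ξ a : ℂ) * z a = 0) :
    2 * (‖ξ‖ ^ 2 * ‖z‖ ^ 2) = ∑ a, ∑ b, ‖(ξ a : ℂ) * z b - ξ b * z a‖ ^ 2 := by
  have hre := congrArg Complex.re h
  have him := congrArg Complex.im h
  simp only [Fin.sum_univ_three, Complex.add_re, Complex.add_im, Complex.re_ofReal_mul,
    Complex.im_ofReal_mul, Complex.zero_re, Complex.zero_im] at hre him
  rw [EuclideanSpace.norm_sq_eq, EuclideanSpace.norm_sq_eq]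
  simp only [Fin.sum_univ_three, Complex.sq_norm, Complex.normSq_apply, Complex.sub_re,
    Complex.sub_im, Complex.re_ofReal_mul, Complex.im_ofReal_mul, Real.norm_eq_abs, sq_abs]
  linear_combination (-2 * (ξ 0 * (z 0).re + ξ 1 * (z 1).re + ξ 2 * (z 2).re)) * hre * (-1) +
    (2 * (ξ 0 * (z 0).im + ξ 1 * (z 1).im + ξ 2 * (z 2).im)) * him

theorem ae_rpow_mul_fhat_le {σ B : ℝ} (hB : 0 ≤ B) {f : L2Field}
    (h : pseudoMeasureNorm σ f ≤ ENNReal.ofReal B) : ∀ᵐ ξ : E3, ‖ξ‖ ^ σ * ‖fhat f ξ‖ ≤ B := by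
  filter_upwards [ENNReal.ae_le_essSup (fun ξ : E3 => ENNReal.ofReal (‖ξ‖ ^ σ * ‖fhat f ξ‖))]
    with ξ hξ
  exact (ENNReal.ofReal_le_ofReal_iff hB).1 (hξ.trans h)

theorem ae_ne_zero : ∀ᵐ ξ : E3, ξ ≠ 0 := by
  simp [ae_iff]

/-- Low frequencies of a weak solution stay bounded by the pseudo-measure norm of the initial
datum and the time integral of the energy. -/
theorem IsWeakSolution.norm_fhat_le {σ B : ℝ} (hσ : σ ∈ Icc (-1 : ℝ) 1) (hB : 0 ≤ B)
    {u₀ : L2Field} {u : ℝ → L2Field} (h0 : pseudoMeasureNorm σ u₀ ≤ ENNReal.ofReal B)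
    (hu : IsWeakSolution u₀ u) {e : ℝ → ℝ} (he : ContinuousOn e (Ici 0))
    (hE : ∀ τ, 0 ≤ τ → ‖u τ‖ ^ 2 ≤ e τ) {t M : ℝ} (ht : 0 ≤ t)
    (hM : ∫ τ in (0 : ℝ)..t, e τ ≤ M) (r : ℝ) :
    ∀ᵐ ξ : E3, ‖ξ‖ < r → ‖fhat (u t) ξ‖ ≤
      (Real.exp (8 * Real.pi ^ 2 * (r ^ 2 * t)) * (6 * B + 24 * Real.pi * (M * r ^ (1 + σ)))) *
        ‖ξ‖ ^ (-σ) := by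
  have hM0 : 0 ≤ M := le_trans (intervalIntegral.integral_nonneg ht fun τ hτ =>
    (sq_nonneg _).trans (hE τ hτ.1)) hM
  have hc : Continuous fun ξ : E3 => 2 * B * ‖ξ‖ ^ (1 - σ) :=
    continuous_const.mul (continuous_norm.rpow_const fun _ => Or.inr (by linarith [hσ.2]))
  have hv : ∀ a b, ∀ᵐ ξ : E3, ‖vort a b u₀ ξ‖ ≤ 2 * B * ‖ξ‖ ^ (1 - σ) := by
    intro a b
    filter_upwards [ae_rpow_mul_fhat_le hB h0, ae_ne_zero] with ξ hξ hξ0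
    have hp : 0 < ‖ξ‖ := norm_pos_iff.2 hξ0
    refine (norm_vort_le a b u₀ ξ).trans ?_
    have h1 : ‖ξ‖ = ‖ξ‖ ^ (1 - σ) * ‖ξ‖ ^ σ := by
      rw [← Real.rpow_add hp]; simp
    calc 2 * ‖ξ‖ * ‖fhat u₀ ξ‖ = 2 * ‖ξ‖ ^ (1 - σ) * (‖ξ‖ ^ σ * ‖fhat u₀ ξ‖) := by
          nth_rewrite 1 [h1]; ring
      _ ≤ 2 * ‖ξ‖ ^ (1 - σ) * B := by gcongr
      _ = _ := by ring
  have hall : ∀ᵐ ξ : E3, ∀ a b, ‖ξ‖ < r → ‖vort a b (u t) ξ‖ ≤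
      Real.exp (2 * (4 * Real.pi ^ 2 * r ^ 2) * t) *
        (2 * B * ‖ξ‖ ^ (1 - σ) + 8 * Real.pi * M * ‖ξ‖ ^ 2) := by
    rw [ae_all_iff]; intro a
    rw [ae_all_iff]; intro b
    exact hu.norm_vort_le_exp he hE ht hM a b hc (hv a b) r
  filter_upwards [hall, (hu.div_free t ht).sum_mul_fhat_eq_zero, ae_ne_zero] with ξ h1 h2 h3 hξ
  have hp : 0 < ‖ξ‖ := norm_pos_iff.2 h3
  set X := Real.exp (2 * (4 * Real.pi ^ 2 * r ^ 2) * t) *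
        (2 * B * ‖ξ‖ ^ (1 - σ) + 8 * Real.pi * M * ‖ξ‖ ^ 2) with hX
  have hX0 : 0 ≤ X := by positivity
  -- the nine components `ξ_a û_b - ξ_b û_a` determine `|ξ| |û|`, because `ξ · û = 0`
  have h4 : 2 * (‖ξ‖ ^ 2 * ‖fhat (u t) ξ‖ ^ 2) ≤ 9 * X ^ 2 := by
    rw [norm_sq_mul_norm_sq_of_sum_eq_zero ξ _ h2]
    calc _ ≤ ∑ a : Fin 3, ∑ b : Fin 3, X ^ 2 :=
          Finset.sum_le_sum fun a _ => Finset.sum_le_sum fun b _ =>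
            pow_le_pow_left₀ (norm_nonneg _) (h1 a b hξ) 2
      _ = 9 * X ^ 2 := by simp; ring
  have h5 : ‖ξ‖ * ‖fhat (u t) ξ‖ ≤ 3 * X := by
    refine abs_le_of_sq_le_sq' ?_ (by positivity) |>.2
    nlinarith [sq_nonneg X]
  have hr : 0 < r := hp.trans hξ
  have e1 : ‖ξ‖ ^ (1 - σ) = ‖ξ‖ * ‖ξ‖ ^ (-σ) := by
    rw [sub_eq_add_neg, Real.rpow_add hp, Real.rpow_one]
  have e2 : ‖ξ‖ ^ 2 = ‖ξ‖ * (‖ξ‖ ^ (1 + σ) * ‖ξ‖ ^ (-σ)) := by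
    rw [← Real.rpow_add hp]; simp [sq]
  -- `|ξ| = |ξ|^{1+σ} |ξ|^{-σ} ≤ r^{1+σ} |ξ|^{-σ}` brings the forcing into the form of the datum
  have h6 : ‖ξ‖ ^ (1 + σ) ≤ r ^ (1 + σ) :=
    Real.rpow_le_rpow hp.le hξ.le (by linarith [hσ.1])
  refine le_of_mul_le_mul_left (h5.trans ?_) hp
  have e3 : 2 * (4 * Real.pi ^ 2 * r ^ 2) * t = 8 * Real.pi ^ 2 * (r ^ 2 * t) := by ring
  rw [hX, e1, e2, e3]
  calc 3 * (Real.exp (8 * Real.pi ^ 2 * (r ^ 2 * t)) * (2 * B * (‖ξ‖ * ‖ξ‖ ^ (-σ)) +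
        8 * Real.pi * M * (‖ξ‖ * (‖ξ‖ ^ (1 + σ) * ‖ξ‖ ^ (-σ)))))
      ≤ 3 * (Real.exp (8 * Real.pi ^ 2 * (r ^ 2 * t)) * (2 * B * (‖ξ‖ * ‖ξ‖ ^ (-σ)) +
        8 * Real.pi * M * (‖ξ‖ * (r ^ (1 + σ) * ‖ξ‖ ^ (-σ))))) := by gcongr
    _ = _ := by ring

/-- The constant in `∫_{|ξ| < r} |ξ|^{-2γ} = ballConst γ * r^{3 - 2γ}`. -/
def ballConst (γ : ℝ) : ℝ := ∫ ξ in Metric.ball (0 : E3) 1, ‖ξ‖ ^ (-(2 * γ))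

theorem integrableOn_ball_norm_rpow {γ : ℝ} (hγ : γ < 3 / 2) (r : ℝ) :
    IntegrableOn (fun ξ : E3 => ‖ξ‖ ^ (-(2 * γ))) (Metric.ball 0 r) := by
  refine integrableOn_ball_of_norm_le_rpow (C := 1) (α := 2 * γ) (by simp) ?_ ?_ ?_
  · simp only [finrank_euclideanSpace, Fintype.card_fin]; push_cast; linarith
  · refine Eventually.of_forall fun ξ => ?_
    rw [Real.norm_of_nonneg (by positivity), one_mul]
  · exact (measurable_norm.pow_const _).aestronglyMeasurable

theorem lintegral_ball_norm_rpow {γ : ℝ} (hγ : γ < 3 / 2) {r : ℝ} (hr : 0 < r) :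
    ∫⁻ ξ in Metric.ball (0 : E3) r, ENNReal.ofReal (‖ξ‖ ^ (-(2 * γ))) =
      ENNReal.ofReal (ballConst γ * r ^ (3 - 2 * γ)) := by
  rw [← ofReal_integral_eq_lintegral_ofReal (integrableOn_ball_norm_rpow hγ r)
    (Eventually.of_forall fun ξ => by positivity)]
  congr 1
  have h := Measure.setIntegral_comp_smul_of_pos (volume : Measure E3)
    (fun ξ : E3 => ‖ξ‖ ^ (-(2 * γ))) (Metric.ball (0 : E3) 1) hr
  rw [smul_unitBall_of_pos hr] at h
  simp only [finrank_euclideanSpace, Fintype.card_fin, smul_eq_mul, norm_smul,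
    Real.norm_of_nonneg hr.le] at h
  simp_rw [Real.mul_rpow hr.le (norm_nonneg _)] at h
  rw [integral_const_mul] at h
  have h3 : r ^ (3 - 2 * γ) = r ^ 3 * r ^ (-(2 * γ)) := by
    rw [sub_eq_add_neg, Real.rpow_add hr]
    norm_cast
  rw [h3, ballConst]
  field_simp at h
  linarith

theorem ballConst_nonneg (γ : ℝ) : 0 ≤ ballConst γ := integral_nonneg fun _ => by positivity

/-- Low frequency part of the negative Sobolev norm. -/
theorem IsWeakSolution.lintegral_ball_le {σ B : ℝ} (hσ : σ ∈ Icc (-1 : ℝ) 1) (hB : 0 ≤ B)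
    {u₀ : L2Field} {u : ℝ → L2Field} (h0 : pseudoMeasureNorm σ u₀ ≤ ENNReal.ofReal B)
    (hu : IsWeakSolution u₀ u) {e : ℝ → ℝ} (he : ContinuousOn e (Ici 0))
    (hE : ∀ τ, 0 ≤ τ → ‖u τ‖ ^ 2 ≤ e τ) {t M : ℝ} (ht : 0 ≤ t)
    (hM : ∫ τ in (0 : ℝ)..t, e τ ≤ M) {r : ℝ} (hr : 0 < r) {δ : ℝ} (hδ : σ + δ < 3 / 2) :
    ∫⁻ ξ in Metric.ball (0 : E3) r, ENNReal.ofReal (‖ξ‖ ^ (-(2 * δ)) * ‖fhat (u t) ξ‖ ^ 2) ≤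
      ENNReal.ofReal ((Real.exp (8 * Real.pi ^ 2 * (r ^ 2 * t)) *
        (6 * B + 24 * Real.pi * (M * r ^ (1 + σ)))) ^ 2 *
          (ballConst (σ + δ) * r ^ (3 - 2 * (σ + δ)))) := by
  set X := Real.exp (8 * Real.pi ^ 2 * (r ^ 2 * t)) *
    (6 * B + 24 * Real.pi * (M * r ^ (1 + σ))) with hX
  rw [ENNReal.ofReal_mul (sq_nonneg X), ← lintegral_ball_norm_rpow hδ hr,
    ← lintegral_const_mul' _ _ ENNReal.ofReal_ne_top]
  refine lintegral_mono_ae ?_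
  rw [ae_restrict_iff' measurableSet_ball]
  filter_upwards [hu.norm_fhat_le hσ hB h0 he hE ht hM r, ae_ne_zero] with ξ h1 h2 hξ
  have hp : 0 < ‖ξ‖ := norm_pos_iff.2 h2
  rw [← ENNReal.ofReal_mul (sq_nonneg X)]
  refine ENNReal.ofReal_le_ofReal ?_
  have h3 := h1 (by simpa using hξ)
  calc ‖ξ‖ ^ (-(2 * δ)) * ‖fhat (u t) ξ‖ ^ 2 ≤ ‖ξ‖ ^ (-(2 * δ)) * (X * ‖ξ‖ ^ (-σ)) ^ 2 := by
        gcongr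
    _ = X ^ 2 * ‖ξ‖ ^ (-(2 * (σ + δ))) := by
        rw [mul_pow, ← Real.rpow_natCast (‖ξ‖ ^ (-σ)), ← Real.rpow_mul hp.le, mul_left_comm,
          ← Real.rpow_add hp]
        congr 2
        push_cast; ring

/-! ### Fourier splitting -/

/-- Global weak solutions obeying the energy inequality, with data bounded by `A` in `L²` and by
`B` in `𝒴^σ`. -/
structure IsAdmissible (σ A B : ℝ) (u₀ : L2Field) (u : ℝ → L2Field) : Prop where
  norm_le : ‖u₀‖ ≤ A
  pseudo_le : pseudoMeasureNorm σ u₀ ≤ ENNReal.ofReal B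
  sol : IsWeakSolution u₀ u
  energy_zero : EnergyInequalityFrom u 0
  energy_ae : ∀ᵐ s ∂(volume.restrict (Ioi (0 : ℝ))), EnergyInequalityFrom u s

/-- `e` dominates the energy `‖u t‖²`, and its time integral grows at most like `m (1 + t)^a`. -/
structure IsEnergyBound (u : ℝ → L2Field) (e : ℝ → ℝ) (m a : ℝ) : Prop where
  cont : ContinuousOn e (Ici 0)
  le : ∀ τ, 0 ≤ τ → ‖u τ‖ ^ 2 ≤ e τ
  integral_le : ∀ t, 0 ≤ t → ∫ τ in (0 : ℝ)..t, e τ ≤ m * (1 + t) ^ a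

theorem EnergyInequalityFrom.norm_sq_le {u : ℝ → L2Field} {s t : ℝ}
    (h : EnergyInequalityFrom u s) (hst : s < t) : ‖u t‖ ^ 2 ≤ ‖u s‖ ^ 2 :=
  (ENNReal.ofReal_le_ofReal_iff (sq_nonneg _)).1 (le_self_add.trans (h t hst))

theorem IsAdmissible.norm_sq_le {σ A B : ℝ} {u₀ : L2Field} {u : ℝ → L2Field}
    (h : IsAdmissible σ A B u₀ u) {t : ℝ} (ht : 0 ≤ t) : ‖u t‖ ^ 2 ≤ A ^ 2 := by
  have h0 : ‖u 0‖ ^ 2 ≤ A ^ 2 := by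
    rw [h.sol.initial]
    exact pow_le_pow_left₀ (norm_nonneg _) h.norm_le 2
  rcases ht.eq_or_lt with rfl | ht
  · exact h0
  · exact (h.energy_zero.norm_sq_le ht).trans h0

/-- Fourier splitting on a time interval `(s, t)`, with the fixed splitting radius `r`: the high
frequencies are damped, and the low ones are bounded by `L`. -/
theorem norm_sq_mul_le_of_low_frequency_le {u : ℝ → L2Field} {s t r L : ℝ} (hs : 0 ≤ s)
    (hst : s < t) (hr : 0 < r) (hL : 0 ≤ L) (hes : EnergyInequalityFrom u s)
    (hae : ∀ᵐ s ∂(volume.restrict (Ioi (0 : ℝ))), EnergyInequalityFrom u s)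
    (hlow : ∀ τ ∈ Ioc s t, ∫⁻ ξ in Metric.ball (0 : E3) r, ENNReal.ofReal (‖fhat (u τ) ξ‖ ^ 2) ≤
      ENNReal.ofReal L) :
    ‖u t‖ ^ 2 * (1 + 8 * Real.pi ^ 2 * r ^ 2 * (t - s)) ≤
      ‖u s‖ ^ 2 + 8 * Real.pi ^ 2 * r ^ 2 * (t - s) * L := by
  set κ : ℝ := 4 * Real.pi ^ 2 * r ^ 2 with hκ
  have hκ0 : 0 ≤ κ := by positivity
  have hd : 0 ≤ t - s := by linarith
  set G : ℝ≥0∞ := ∫⁻ τ in Ioc s t, gradNormSq (u τ) with hG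
  have h1 : ENNReal.ofReal (κ * ‖u t‖ ^ 2 * (t - s)) ≤ ENNReal.ofReal (κ * L * (t - s)) + G := by
    have h2 : ∀ c : ℝ, 0 ≤ c → ENNReal.ofReal (c * (t - s)) =
        ∫⁻ _ in Ioc s t, ENNReal.ofReal c := by
      intro c hc
      rw [setLIntegral_const, Real.volume_Ioc, ENNReal.ofReal_mul hc]
    rw [h2 _ (by positivity), h2 _ (by positivity), hG, ← lintegral_add_left measurable_const]
    refine lintegral_mono_ae ?_
    -- the energy inequality started at almost every `τ` makes the energy decrease from `τ` to `t`
    have hmono : ∀ᵐ τ ∂(volume.restrict (Ioc s t)), τ ≠ t → ‖u t‖ ^ 2 ≤ ‖u τ‖ ^ 2 := by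
      have hsub : Ioc s t ⊆ Ioi 0 := fun τ hτ => hs.trans_lt hτ.1
      filter_upwards [ae_restrict_of_ae_restrict_of_subset hsub hae,
        ae_restrict_mem measurableSet_Ioc] with τ h3 h4 h5
      exact h3.norm_sq_le (lt_of_le_of_ne h4.2 h5)
    filter_upwards [hmono, ae_restrict_mem measurableSet_Ioc] with τ h3 h4
    have h5 : ‖u t‖ ^ 2 ≤ ‖u τ‖ ^ 2 := by
      by_cases h : τ = t
      · rw [h]
      · exact h3 h
    calc ENNReal.ofReal (κ * ‖u t‖ ^ 2) ≤ ENNReal.ofReal κ * ENNReal.ofReal (‖u τ‖ ^ 2) := by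
          rw [← ENNReal.ofReal_mul hκ0]
          gcongr
      _ ≤ ENNReal.ofReal κ * (∫⁻ ξ in Metric.ball 0 r, ENNReal.ofReal (‖fhat (u τ) ξ‖ ^ 2)) +
            gradNormSq (u τ) := energy_le_low_add_gradNormSq (u τ) hr
      _ ≤ ENNReal.ofReal (κ * L) + gradNormSq (u τ) := by
          rw [ENNReal.ofReal_mul hκ0]
          gcongr
          exact hlow τ h4
  have h6 := hes t hst
  have h7 : ENNReal.ofReal (‖u t‖ ^ 2 + 2 * (κ * ‖u t‖ ^ 2 * (t - s))) ≤
      ENNReal.ofReal (‖u s‖ ^ 2 + 2 * (κ * L * (t - s))) := by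
    rw [ENNReal.ofReal_add (by positivity) (by positivity),
      ENNReal.ofReal_add (by positivity) (by positivity), ENNReal.ofReal_mul zero_le_two,
      ENNReal.ofReal_mul zero_le_two, ENNReal.ofReal_ofNat]
    calc _ ≤ ENNReal.ofReal (‖u t‖ ^ 2) + 2 * (ENNReal.ofReal (κ * L * (t - s)) + G) := by gcongr
      _ = (ENNReal.ofReal (‖u t‖ ^ 2) + 2 * G) + 2 * ENNReal.ofReal (κ * L * (t - s)) := by ring
      _ ≤ _ := by gcongr
  have h8 := (ENNReal.ofReal_le_ofReal_iff (by positivity)).1 h7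
  rw [hκ] at h8
  linarith

/-- The splitting radius `2 (1 + t)^{-1/2}`, the parabolic frequency scale at time `t`. The factor
`2` makes the gain `1 / 64` possible in `norm_sq_le_of_low_frequency_decay`. -/
def splitRadius (t : ℝ) : ℝ := 2 * (1 + t) ^ (-(1 / 2) : ℝ)

theorem splitRadius_pos {t : ℝ} (ht : 0 ≤ t) : 0 < splitRadius t := by
  unfold splitRadius; positivity

theorem splitRadius_rpow {t : ℝ} (ht : 0 ≤ t) (p : ℝ) :
    splitRadius t ^ p = 2 ^ p * (1 + t) ^ (-(p / 2)) := by
  unfold splitRadius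
  rw [Real.mul_rpow zero_le_two (by positivity), ← Real.rpow_mul (by positivity)]
  congr 2
  ring

theorem splitRadius_sq {t : ℝ} (ht : 0 ≤ t) : splitRadius t ^ 2 = 4 / (1 + t) := by
  rw [← Real.rpow_natCast, splitRadius_rpow ht]
  norm_num
  rw [Real.rpow_neg_one]
  rfl

/-- The low frequency bound at the splitting radius. -/
theorem IsAdmissible.lintegral_ball_le {σ A B : ℝ} (hσ : σ ∈ Icc (-1 : ℝ) 1) (hB : 0 ≤ B)
    {u₀ : L2Field} {u : ℝ → L2Field} (h : IsAdmissible σ A B u₀ u) {e : ℝ → ℝ} {m a : ℝ}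
    (ha : 0 ≤ a) (hm : 0 ≤ m) (he : IsEnergyBound u e m a) {τ t : ℝ} (hτ : 0 ≤ τ) (hτt : τ ≤ t)
    {δ : ℝ} (hδ : σ + δ < 3 / 2) :
    ∫⁻ ξ in Metric.ball (0 : E3) (splitRadius t),
        ENNReal.ofReal (‖ξ‖ ^ (-(2 * δ)) * ‖fhat (u τ) ξ‖ ^ 2) ≤
      ENNReal.ofReal ((Real.exp (32 * Real.pi ^ 2) *
        (6 * B + 96 * Real.pi * m * (1 + t) ^ (a - (1 + σ) / 2))) ^ 2 *
          (ballConst (σ + δ) * (2 ^ (3 - 2 * (σ + δ)) * (1 + t) ^ (-(3 / 2 - (σ + δ)))))) := by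
  have ht : 0 ≤ t := hτ.trans hτt
  have hp : 0 < 1 + t := by linarith
  have hM : ∫ s in (0 : ℝ)..τ, e s ≤ m * (1 + t) ^ a := by
    refine (he.integral_le τ hτ).trans ?_
    gcongr
  have hr := splitRadius_pos ht
  refine (h.sol.lintegral_ball_le hσ hB h.pseudo_le he.cont he.le hτ hM hr hδ).trans ?_
  refine ENNReal.ofReal_le_ofReal ?_
  have e1 : splitRadius t ^ (3 - 2 * (σ + δ)) =
      2 ^ (3 - 2 * (σ + δ)) * (1 + t) ^ (-(3 / 2 - (σ + δ))) := by
    rw [splitRadius_rpow ht]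
    congr 2
    ring
  have e2 : 8 * Real.pi ^ 2 * (splitRadius t ^ 2 * τ) ≤ 32 * Real.pi ^ 2 := by
    have : splitRadius t ^ 2 * τ ≤ 4 := by
      rw [splitRadius_sq ht, div_mul_eq_mul_div, div_le_iff₀ hp]
      linarith
    nlinarith [sq_nonneg Real.pi]
  have e3 : m * (1 + t) ^ a * splitRadius t ^ (1 + σ) ≤
      4 * m * (1 + t) ^ (a - (1 + σ) / 2) := by
    rw [splitRadius_rpow ht, sub_eq_add_neg, Real.rpow_add hp]
    have : (2 : ℝ) ^ (1 + σ) ≤ 4 := by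
      calc (2 : ℝ) ^ (1 + σ) ≤ 2 ^ (2 : ℝ) :=
            Real.rpow_le_rpow_of_exponent_le one_le_two (by linarith [hσ.2])
        _ = 4 := by norm_num
    calc m * (1 + t) ^ a * (2 ^ (1 + σ) * (1 + t) ^ (-((1 + σ) / 2)))
        ≤ m * (1 + t) ^ a * (4 * (1 + t) ^ (-((1 + σ) / 2))) := by gcongr
      _ = _ := by ring
  rw [e1]
  have hb := ballConst_nonneg (σ + δ)
  have hrp : 0 ≤ splitRadius t ^ (1 + σ) := by positivity
  have e4 : 6 * B + 24 * Real.pi * (m * (1 + t) ^ a * splitRadius t ^ (1 + σ)) ≤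
      6 * B + 96 * Real.pi * m * (1 + t) ^ (a - (1 + σ) / 2) := by
    have := mul_le_mul_of_nonneg_left e3 (by positivity : 0 ≤ 24 * Real.pi)
    linarith
  gcongr

/-- Iterating the Fourier splitting estimate over dyadic time scales. Each step gains the factor
`1 / 64`, which beats the loss `4 ^ β ≤ 32` between the times `s ≥ t / 4` and `t`. -/
theorem norm_sq_le_of_low_frequency_decay {u : ℝ → L2Field} {K L β : ℝ} (hβ0 : 0 ≤ β)
    (hβ : β ≤ 5 / 2) (hK : ∀ t, 0 ≤ t → ‖u t‖ ^ 2 ≤ K) (hL : 0 ≤ L)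
    (hae : ∀ᵐ s ∂(volume.restrict (Ioi (0 : ℝ))), EnergyInequalityFrom u s)
    (hlow : ∀ τ t, 0 ≤ τ → τ ≤ t → ∫⁻ ξ in Metric.ball (0 : E3) (splitRadius t),
      ENNReal.ofReal (‖fhat (u τ) ξ‖ ^ 2) ≤ ENNReal.ofReal (L * (1 + t) ^ (-β)))
    {t : ℝ} (ht : 0 ≤ t) : ‖u t‖ ^ 2 ≤ (8 * K + 2 * L) * (1 + t) ^ (-β) := by
  have hK0 : 0 ≤ K := (sq_nonneg _).trans (hK 0 le_rfl)
  have key : ∀ n : ℕ, ∀ t, 0 ≤ t → t ≤ 2 ^ n →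
      ‖u t‖ ^ 2 ≤ (8 * K + 2 * L) * (1 + t) ^ (-β) := by
    have hbase : ∀ t, 0 ≤ t → t ≤ 1 → ‖u t‖ ^ 2 ≤ (8 * K + 2 * L) * (1 + t) ^ (-β) := by
      intro t ht ht1
      have h1 : (1 / 8 : ℝ) ≤ (1 + t) ^ (-β) := by
        calc (1 / 8 : ℝ) = 2 ^ (-3 : ℝ) := by
              rw [Real.rpow_neg zero_le_two]; norm_num
          _ ≤ 2 ^ (-β) := Real.rpow_le_rpow_of_exponent_le one_le_two (by linarith)
          _ ≤ (1 + t) ^ (-β) :=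
              Real.rpow_le_rpow_of_nonpos (by linarith) (by linarith) (by linarith)
      have h2 := hK t ht
      nlinarith
    intro n
    induction n with
    | zero => intro t ht ht1; exact hbase t ht (by simpa using ht1)
    | succ n ih =>
      intro t ht htn
      rcases le_total t 1 with ht1 | ht1
      · exact hbase t ht ht1
      have hsub : Ioo (t / 4) (t / 2) ⊆ Ioi 0 := fun s hs => by
        have := hs.1
        simp only [mem_Ioi]; linarith
      have : (ae (volume.restrict (Ioo (t / 4) (t / 2)))).NeBot := by
        rw [ae_restrict_neBot, Real.volume_Ioo]
        simp only [ne_eq, ENNReal.ofReal_eq_zero, not_le]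
        linarith
      obtain ⟨s, hes, hs⟩ := ((ae_restrict_of_ae_restrict_of_subset hsub hae).and
        (ae_restrict_mem measurableSet_Ioo)).exists
      have hs0 : 0 ≤ s := by linarith [hs.1]
      have hp : 0 < 1 + t := by linarith
      have hIH := ih s hs0 (by rw [pow_succ] at htn; linarith [hs.2])
      set D := (1 + t) ^ (-β) with hD
      have hD0 : 0 < D := by positivity
      have h1 := norm_sq_mul_le_of_low_frequency_le hs0 (by linarith [hs.2]) (splitRadius_pos ht)
        (mul_nonneg hL hD0.le) hes hae
        fun τ hτ => hlow τ t (hs0.trans hτ.1.le) hτ.2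
      rw [splitRadius_sq ht] at h1
      set y := 8 * Real.pi ^ 2 * (4 / (1 + t)) * (t - s) with hy
      have hy63 : 63 ≤ y := by
        have h2 : 9 < Real.pi ^ 2 := by nlinarith [Real.pi_gt_three]
        have h3 : 1 ≤ 4 / (1 + t) * (t - s) := by
          rw [div_mul_eq_mul_div, le_div_iff₀ hp]
          linarith [hs.2]
        calc (63 : ℝ) ≤ 8 * Real.pi ^ 2 * 1 := by linarith
          _ ≤ 8 * Real.pi ^ 2 * (4 / (1 + t) * (t - s)) := by gcongr
          _ = y := by rw [hy]; ring
      have h4 : (1 + s) ^ (-β) ≤ 32 * D := by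
        calc (1 + s) ^ (-β) ≤ ((1 + t) / 4) ^ (-β) :=
              Real.rpow_le_rpow_of_nonpos (by positivity) (by linarith [hs.1]) (by linarith)
          _ = 4 ^ β * D := by
              rw [Real.div_rpow hp.le (by norm_num), Real.rpow_neg (by norm_num : (0 : ℝ) ≤ 4),
                div_inv_eq_mul, mul_comm]
          _ ≤ 32 * D := by
              gcongr
              calc (4 : ℝ) ^ β ≤ 4 ^ (5 / 2 : ℝ) :=
                    Real.rpow_le_rpow_of_exponent_le (by norm_num) hβ
                _ = 32 := by
                    rw [show (4 : ℝ) = 2 ^ (2 : ℝ) by norm_num, ← Real.rpow_mul zero_le_two]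
                    norm_num
      have h5 : ‖u s‖ ^ 2 ≤ (8 * K + 2 * L) * (32 * D) :=
        hIH.trans (mul_le_mul_of_nonneg_left h4 (by positivity))
      -- with `E = ‖u t‖²` and `C = 8 K + 2 L`, this is `E (1 + y) ≤ 32 C D + y L D`, where `y ≥ 63`
      by_contra hcon
      push Not at hcon
      have h6 : (8 * K + 2 * L) * D * (1 + y) < ‖u t‖ ^ 2 * (1 + y) :=
        mul_lt_mul_of_pos_right hcon (by linarith)
      have h7 : 0 ≤ K * D := by positivity
      have h8 : 0 ≤ L * D := by positivity
      nlinarith [mul_nonneg h7 (by linarith : 0 ≤ y - 63), mul_nonneg h8 (by linarith : 0 ≤ y - 63)]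
  obtain ⟨n, hn⟩ := pow_unbounded_of_one_lt t (one_lt_two (α := ℝ))
  exact key n t ht hn.le

/-- One step of the bootstrap: growth `(1 + t)^a` of the time integral of the energy implies decay
of the energy. -/
theorem exists_decay_of_energyBound {σ A B : ℝ} (hσ : σ ∈ Icc (-1 : ℝ) 1) (hB : 0 ≤ B)
    {m a β : ℝ} (hm : 0 ≤ m) (ha : 0 ≤ a) (hβ0 : 0 ≤ β) (hβσ : β ≤ 3 / 2 - σ)
    (hβa : β ≤ 5 / 2 - 2 * a) :
    ∃ C, 0 ≤ C ∧ ∀ u₀ u, IsAdmissible σ A B u₀ u → ∀ e, IsEnergyBound u e m a →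
      ∀ t, 0 ≤ t → ‖u t‖ ^ 2 ≤ C * (1 + t) ^ (-β) := by
  have hb := ballConst_nonneg σ
  set L : ℝ := Real.exp (32 * Real.pi ^ 2) ^ 2 * (2 * ((6 * B) ^ 2 + (96 * Real.pi * m) ^ 2)) *
    (ballConst σ * 2 ^ (3 - 2 * σ)) with hL
  have hL0 : 0 ≤ L := by positivity
  refine ⟨8 * A ^ 2 + 2 * L, by positivity, fun u₀ u h e he t ht =>
    norm_sq_le_of_low_frequency_decay hβ0 (by linarith) (fun t ht => h.norm_sq_le ht) hL0
      h.energy_ae (fun τ t hτ hτt => ?_) ht⟩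
  have ht : 0 ≤ t := hτ.trans hτt
  have hp : 0 < 1 + t := by linarith
  have h1 := h.lintegral_ball_le hσ hB ha hm he hτ hτt (δ := 0) (by linarith [hσ.2])
  simp only [mul_zero, neg_zero, Real.rpow_zero, one_mul, add_zero] at h1
  refine h1.trans (ENNReal.ofReal_le_ofReal ?_)
  set z := (1 + t) ^ (a - (1 + σ) / 2) with hz
  set w := (1 + t) ^ (-(3 / 2 - σ)) with hw
  have hw0 : 0 ≤ w := by positivity
  have h2 : w ≤ (1 + t) ^ (-β) :=
    Real.rpow_le_rpow_of_exponent_le (by linarith) (by linarith)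
  have h3 : z ^ 2 * w ≤ (1 + t) ^ (-β) := by
    rw [hz, hw, ← Real.rpow_natCast, ← Real.rpow_mul hp.le, ← Real.rpow_add hp]
    refine Real.rpow_le_rpow_of_exponent_le (by linarith) ?_
    push_cast
    linarith
  have h4 : (6 * B + 96 * Real.pi * m * z) ^ 2 ≤
      2 * ((6 * B) ^ 2 + (96 * Real.pi * m) ^ 2 * z ^ 2) := by
    nlinarith [sq_nonneg (6 * B - 96 * Real.pi * m * z)]
  calc (Real.exp (32 * Real.pi ^ 2) * (6 * B + 96 * Real.pi * m * z)) ^ 2 *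
        (ballConst σ * (2 ^ (3 - 2 * σ) * w))
      = Real.exp (32 * Real.pi ^ 2) ^ 2 * (ballConst σ * 2 ^ (3 - 2 * σ)) *
        ((6 * B + 96 * Real.pi * m * z) ^ 2 * w) := by ring
    _ ≤ Real.exp (32 * Real.pi ^ 2) ^ 2 * (ballConst σ * 2 ^ (3 - 2 * σ)) *
        (2 * ((6 * B) ^ 2 + (96 * Real.pi * m) ^ 2 * z ^ 2) * w) := by gcongr
    _ = Real.exp (32 * Real.pi ^ 2) ^ 2 * (ballConst σ * 2 ^ (3 - 2 * σ)) *
        (2 * ((6 * B) ^ 2 * w + (96 * Real.pi * m) ^ 2 * (z ^ 2 * w))) := by ring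
    _ ≤ Real.exp (32 * Real.pi ^ 2) ^ 2 * (ballConst σ * 2 ^ (3 - 2 * σ)) *
        (2 * ((6 * B) ^ 2 * (1 + t) ^ (-β) + (96 * Real.pi * m) ^ 2 * (1 + t) ^ (-β))) := by
        gcongr
    _ = L * (1 + t) ^ (-β) := by rw [hL]; ring

/-! ### The bootstrap and the negative Sobolev norm -/

theorem integral_one_add_rpow {q t : ℝ} (hq : q ≠ 0) (ht : 0 ≤ t) :
    ∫ τ in (0 : ℝ)..t, (1 + τ) ^ (q - 1) = ((1 + t) ^ q - 1) / q := by
  have h : ∀ s ∈ uIcc 0 t, HasDerivAt (fun s : ℝ => (1 + s) ^ q / q) ((1 + s) ^ (q - 1)) s := by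
    intro s hs
    rw [uIcc_of_le ht] at hs
    have h1 : HasDerivAt (fun s : ℝ => 1 + s) 1 s := (hasDerivAt_id s).const_add 1
    refine ((h1.rpow_const (p := q) (Or.inl (by linarith [hs.1]))).div_const q).congr_deriv ?_
    field_simp
  rw [intervalIntegral.integral_eq_sub_of_hasDerivAt h]
  · simp; ring
  · refine ContinuousOn.intervalIntegrable fun s hs => ?_
    rw [uIcc_of_le ht] at hs
    have : (1 + s) ≠ 0 := by linarith [hs.1]
    exact (ContinuousAt.rpow_const (by fun_prop) (Or.inl this)).continuousWithinAt

theorem isEnergyBound_of_decay {u : ℝ → L2Field} {C β : ℝ}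
    (h : ∀ t, 0 ≤ t → ‖u t‖ ^ 2 ≤ C * (1 + t) ^ (-β)) {m a : ℝ}
    (hi : ∀ t, 0 ≤ t → ∫ τ in (0 : ℝ)..t, C * (1 + τ) ^ (-β) ≤ m * (1 + t) ^ a) :
    IsEnergyBound u (fun τ => C * (1 + τ) ^ (-β)) m a where
  cont := by
    intro s hs
    have : (1 + s) ≠ 0 := by linarith [mem_Ici.1 hs]
    exact (continuousAt_const.mul
      (ContinuousAt.rpow_const (by fun_prop) (Or.inl this))).continuousWithinAt
  le := h
  integral_le := hi

/-- The outcome of the bootstrap: the sharp energy decay, together with a growth rate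
`a ≤ (1 + σ) / 2` of the time integral of the energy. -/
theorem exists_energy_decay {σ A B : ℝ} (hσ : σ ∈ Icc (-1 : ℝ) 1) (hB : 0 ≤ B) :
    ∃ a m C, 0 ≤ a ∧ a ≤ (1 + σ) / 2 ∧ 0 ≤ m ∧ 0 ≤ C ∧ ∀ u₀ u, IsAdmissible σ A B u₀ u →
      (∃ e, IsEnergyBound u e m a) ∧ ∀ t, 0 ≤ t → ‖u t‖ ^ 2 ≤ C * (1 + t) ^ (-(3 / 2 - σ)) := by
  have hb1 : ∀ u₀ u, IsAdmissible σ A B u₀ u → IsEnergyBound u (fun _ => A ^ 2) (A ^ 2) 1 := by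
    intro u₀ u h
    refine ⟨continuousOn_const, fun τ hτ => h.norm_sq_le hτ, fun t ht => ?_⟩
    rw [intervalIntegral.integral_const, Real.rpow_one, smul_eq_mul, sub_zero, mul_comm]
    exact mul_le_mul_of_nonneg_left (by linarith) (sq_nonneg A)
  obtain ⟨C₁, hC₁, h1⟩ := exists_decay_of_energyBound (A := A) hσ hB (sq_nonneg A) zero_le_one
    (β := 1 / 2) (by norm_num) (by linarith [hσ.2]) (by norm_num)
  have hb2 : ∀ u₀ u, IsAdmissible σ A B u₀ u →
      IsEnergyBound u (fun τ => C₁ * (1 + τ) ^ (-(1 / 2) : ℝ)) (2 * C₁) (1 / 2) := by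
    intro u₀ u h
    refine isEnergyBound_of_decay (h1 u₀ u h _ (hb1 u₀ u h)) fun t ht => ?_
    have h2 := integral_one_add_rpow (q := 1 / 2) (by norm_num) ht
    norm_num at h2
    rw [intervalIntegral.integral_const_mul]
    norm_num
    rw [h2]
    nlinarith
  -- for `σ ≥ 0` the rate `a = 1 / 2` is already admissible; otherwise one more step is needed to
  -- make the energy integrable in time
  rcases le_total 0 σ with hs | hs
  · obtain ⟨C₂, hC₂, h2⟩ := exists_decay_of_energyBound (A := A) hσ hB
      (by positivity : 0 ≤ 2 * C₁) (by norm_num : (0 : ℝ) ≤ 1 / 2) (β := 3 / 2 - σ)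
      (by linarith [hσ.2]) le_rfl (by linarith)
    exact ⟨1 / 2, 2 * C₁, C₂, by norm_num, by linarith, by positivity, hC₂, fun u₀ u h =>
      ⟨⟨_, hb2 u₀ u h⟩, h2 u₀ u h _ (hb2 u₀ u h)⟩⟩
  · obtain ⟨C₂, hC₂, h2⟩ := exists_decay_of_energyBound (A := A) hσ hB
      (by positivity : 0 ≤ 2 * C₁) (by norm_num : (0 : ℝ) ≤ 1 / 2) (β := 3 / 2)
      (by norm_num) (by linarith) (by norm_num)
    have hb3 : ∀ u₀ u, IsAdmissible σ A B u₀ u →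
        IsEnergyBound u (fun τ => C₂ * (1 + τ) ^ (-(3 / 2) : ℝ)) (2 * C₂) 0 := by
      intro u₀ u h
      refine isEnergyBound_of_decay (h2 u₀ u h _ (hb2 u₀ u h)) fun t ht => ?_
      have h3 := integral_one_add_rpow (q := -(1 / 2)) (by norm_num) ht
      have h4 : (-(1 / 2) - 1 : ℝ) = -(3 / 2) := by norm_num
      rw [h4] at h3
      rw [intervalIntegral.integral_const_mul, h3, Real.rpow_zero]
      have : 0 ≤ (1 + t) ^ (-(1 / 2) : ℝ) := by positivity
      have h5 : ((1 + t) ^ (-(1 / 2) : ℝ) - 1) / (-(1 / 2)) ≤ 2 := by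
        linarith
      nlinarith
    obtain ⟨C₃, hC₃, h3⟩ := exists_decay_of_energyBound (A := A) hσ hB
      (by positivity : 0 ≤ 2 * C₂) le_rfl (β := 3 / 2 - σ)
      (by linarith [hσ.2]) le_rfl (by linarith [hσ.1])
    exact ⟨0, 2 * C₂, C₃, le_rfl, by linarith [hσ.1], by positivity, hC₃, fun u₀ u h =>
      ⟨⟨_, hb3 u₀ u h⟩, h3 u₀ u h _ (hb3 u₀ u h)⟩⟩

/-- The decay in `Ḣ^{-δ}`: the low frequencies are integrated against the pointwise bound on `û`,
the high ones are controlled by the energy decay. -/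
theorem exists_homSobolevNormSq_le {σ δ A B : ℝ} (hσ : σ ∈ Icc (-1 : ℝ) 1) (hB : 0 ≤ B)
    (hδ : 0 < δ) (hδσ : δ < 3 / 2 - σ) :
    ∃ C : ℝ, ∀ u₀ u, IsAdmissible σ A B u₀ u → ∀ t, 0 ≤ t →
      homSobolevNormSq (-δ) (u t) ≤
        ENNReal.ofReal (C * (1 + t) ^ (-(3 / 2 : ℝ) + σ + δ)) := by
  obtain ⟨a, m, C, ha, haσ, hm, hC, hmain⟩ := exists_energy_decay (A := A) hσ hB
  have hb := ballConst_nonneg (σ + δ)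
  set C' : ℝ := (Real.exp (32 * Real.pi ^ 2) * (6 * B + 96 * Real.pi * m)) ^ 2 *
    (ballConst (σ + δ) * 2 ^ (3 - 2 * (σ + δ))) with hC'
  refine ⟨C' + C, fun u₀ u h t ht => ?_⟩
  obtain ⟨⟨e, he⟩, hdec⟩ := hmain u₀ u h
  have hp : 0 < 1 + t := by linarith
  have hr := splitRadius_pos ht
  set D := (1 + t) ^ (-(3 / 2 : ℝ) + σ + δ) with hD
  have hD0 : 0 ≤ D := by positivity
  have hC'0 : 0 ≤ C' := by positivity
  rw [homSobolevNormSq, ← lintegral_add_compl _ (measurableSet_ball (x := (0 : E3))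
    (ε := splitRadius t)), add_mul, ENNReal.ofReal_add (by positivity) (by positivity)]
  simp only [mul_neg]
  refine add_le_add ?_ ?_
  · refine (h.lintegral_ball_le hσ hB ha hm he ht le_rfl (by linarith)).trans
      (ENNReal.ofReal_le_ofReal ?_)
    have h1 : (1 + t) ^ (a - (1 + σ) / 2) ≤ 1 :=
      Real.rpow_le_one_of_one_le_of_nonpos (by linarith) (by linarith)
    have h2 : (1 + t) ^ (-(3 / 2 - (σ + δ))) = D := by
      rw [hD]; congr 1; ring
    rw [h2]
    have h3 : 6 * B + 96 * Real.pi * m * (1 + t) ^ (a - (1 + σ) / 2) ≤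
        6 * B + 96 * Real.pi * m := by
      have := mul_le_mul_of_nonneg_left h1 (by positivity : 0 ≤ 96 * Real.pi * m)
      linarith
    calc _ ≤ (Real.exp (32 * Real.pi ^ 2) * (6 * B + 96 * Real.pi * m)) ^ 2 *
          (ballConst (σ + δ) * (2 ^ (3 - 2 * (σ + δ)) * D)) := by gcongr
      _ = C' * D := by rw [hC']; ring
  · calc ∫⁻ ξ in (Metric.ball (0 : E3) (splitRadius t))ᶜ,
          ENNReal.ofReal (‖ξ‖ ^ (-(2 * δ)) * ‖fhat (u t) ξ‖ ^ 2)
        ≤ ∫⁻ ξ in (Metric.ball (0 : E3) (splitRadius t))ᶜ,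
          ENNReal.ofReal ((1 + t) ^ δ) * ENNReal.ofReal (‖fhat (u t) ξ‖ ^ 2) := by
          refine setLIntegral_mono' measurableSet_ball.compl fun ξ hξ => ?_
          rw [← ENNReal.ofReal_mul (by positivity)]
          refine ENNReal.ofReal_le_ofReal (mul_le_mul_of_nonneg_right ?_ (sq_nonneg _))
          have h1 : splitRadius t ≤ ‖ξ‖ := by simpa using hξ
          calc ‖ξ‖ ^ (-(2 * δ)) ≤ splitRadius t ^ (-(2 * δ)) :=
                Real.rpow_le_rpow_of_nonpos hr h1 (by linarith)
            _ = 2 ^ (-(2 * δ)) * (1 + t) ^ δ := by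
                rw [splitRadius_rpow ht]; congr 2; ring
            _ ≤ 1 * (1 + t) ^ δ := by
                gcongr
                exact Real.rpow_le_one_of_one_le_of_nonpos one_le_two (by linarith)
            _ = (1 + t) ^ δ := one_mul _
      _ ≤ ENNReal.ofReal ((1 + t) ^ δ) * ENNReal.ofReal (‖u t‖ ^ 2) := by
          rw [lintegral_const_mul' _ _ ENNReal.ofReal_ne_top, ← lintegral_fhat_sq]
          gcongr
          exact Measure.restrict_le_self
      _ ≤ ENNReal.ofReal (C * D) := by
          rw [← ENNReal.ofReal_mul (by positivity)]
          refine ENNReal.ofReal_le_ofReal ?_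
          calc (1 + t) ^ δ * ‖u t‖ ^ 2 ≤ (1 + t) ^ δ * (C * (1 + t) ^ (-(3 / 2 - σ))) := by
                gcongr
                exact hdec t ht
            _ = C * D := by
                rw [hD, mul_left_comm, ← Real.rpow_add hp]
                congr 2
                ring

end

end NSE

theorem corollary1 (σ δ : ℝ) (hσ : σ ∈ Set.Icc (-1 : ℝ) 1) (hδ : 0 < δ) (hδσ : δ < 3 / 2 - σ)
    (A B : ℝ) :
    ∃ C : ℝ, ∀ (u₀ : NSE.L2Field) (u : ℝ → NSE.L2Field),
      ‖u₀‖ ≤ A →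
      NSE.pseudoMeasureNorm σ u₀ ≤ ENNReal.ofReal B →
      NSE.WeaklyDivFree u₀ →
      NSE.IsWeakSolution u₀ u →
      NSE.EnergyInequalityFrom u 0 →
      (∀ᵐ s ∂(MeasureTheory.volume.restrict (Set.Ioi (0 : ℝ))), NSE.EnergyInequalityFrom u s) →
      ∀ t : ℝ, 0 ≤ t →
        NSE.homSobolevNormSq (-δ) (u t) ≤
          ENNReal.ofReal (C * (1 + t) ^ (-(3 / 2 : ℝ) + σ + δ)) := by
  obtain ⟨C, hC⟩ := NSE.exists_homSobolevNormSq_le (A := A) hσ (le_max_right B 0) hδ hδσ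
  refine ⟨C, fun u₀ u hA hB _ hu h0 hae => hC u₀ u ⟨hA, hB.trans ?_, hu, h0, hae⟩⟩
  exact ENNReal.ofReal_le_ofReal (le_max_left B 0)
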